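/- Let $K$ be a field containing $\mathbb{Q}$, let $X=\{x_1,x_2,\dots\}$, and let $[X]$ be the free abelian monoid of monomials in $X$. Let $R'\subset K[[X]]$ be the ring of formal polynomials, that is, of all power series whose support has bounded total degree. Fix $r\ge 1$ and a map $y:\{1,2,\dots\}\to\{1,\dots,r\}$ (a division of the variables into $r$ blocks), and let $\deg:[X]\to\mathbb{N}^r$ be the monoid homomorphism with $\deg(x_i)=e_{y(i)}$. An ideal $I\subset R'$ is called *$r$-homogeneous* if it contains every $\deg$-homogeneous component of each of its elements, *lfg* if it is generated by a set $\bigcup_{d\ge1}F_d$ with each $F_d$ a finite set of forms of total degree $d$, and *monomial* if it is generated by monomials. A *term order* is a multiplicative total order $>$ on $[X]$ whose restriction to $X$ is order-isomorphic to $-\omega$ (the reversed natural numbers). The initial ideal $\mathrm{in}_>(I)$ is the ideal of $R'$ generated by the largest monomials of the supports of the nonzero elements of $I$. Let $\rho_n:R'\to K[x_1,\dots,x_n]$ be the homomorphism that kills $x_i$ for $i>n$ and fixes $x_1,\dots,x_n$. For an $r$-homogeneous ideal $I$ let $g_n^I\in\mathbb{Z}[[t_1,\dots,t_r]]$ be the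 series such that $g_n^I/\prod_{i=1}^n(1-t_{y(i)})$ is the $\mathbb{N}^r$-graded Hilbert series of $K[x_1,\dots,x_n]/\rho_n(I)$. The limit of $g^I_n$ as $n\to\infty$ in the $(t_1,\dots,t_r)$-adic topology is called the *$r$-graded Hilbert numerator* of $I$. For a monomial ideal $J$ put $$p(J)=\prod_{i\ge1}(1-x_i)\cdot\sum_{m\in[X]\setminus J}m\in\mathbb{Z}[[X]].$$ Let $\mathcal{S}\subset\mathbb{Z}[[X]]$ be the set of series all of whose components of fixed total degree are polynomials, and let $\mathrm{Coll}:\mathcal{S}\to\mathbb{Z}[[t_1,\dots,t_r]]$ be the substitution $x_i\mapsto t_{y(i)}$. (a) Let $I\subset R'$ be an $r$-homogeneous lfg ideal and let $>$ be a term order. Then $\mathrm{in}_>(I)$ is an $r$-homogeneous lfg monomial ideal, $p(\mathrm{in}_>(I))\in\mathcal{S}$, the $r$-graded Hilbert numerators of $I$ and of $\mathrm{in}_>(I)$ both exist, and they are equal; their common value is $\mathrm{Coll}(p(\mathrm{in}_>(I)))$. (b) Consequently the set of $r$-graded Hilbert numerators of $r$-homogeneous lfg ideals of $R'$ equals the set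 of $r$-graded Hilbert numerators of lfg monomial ideals of $R'$, and it is also equal to the set of all $\mathrm{Coll}(p(J))$ with $J$ an lfg monomial ideal. -/

import Mathlib

noncomputable section

namespace LargePoly

/-- The ring of formal polynomials in the indeterminates `x_0, x_1, x_2, …` over `K`: the subring
of the power series ring `K[[x_0, x_1, …]]` of all elements of bounded total degree. A monomial
is an exponent vector `m : ℕ →₀ ℕ`, and the product of monomials is the sum of exponents. -/
def RP (K : Type*) [Field K] : Subalgebra K (MvPowerSeries ℕ K) where
  carrier := {f | ∃ d : ℕ, ∀ m : ℕ →₀ ℕ, MvPowerSeries.coeff m f ≠ 0 → m.degree ≤ d}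
  mul_mem' := by
    rintro f g ⟨a, ha⟩ ⟨b, hb⟩
    refine ⟨a + b, fun m hm => ?_⟩
    classical
    rw [MvPowerSeries.coeff_mul] at hm
    obtain ⟨p, hp, hne⟩ := Finset.exists_ne_zero_of_sum_ne_zero hm
    rw [Finset.HasAntidiagonal.mem_antidiagonal] at hp
    rw [← hp, map_add]
    exact add_le_add (ha _ (left_ne_zero_of_mul hne)) (hb _ (right_ne_zero_of_mul hne))
  add_mem' := by
    rintro f g ⟨a, ha⟩ ⟨b, hb⟩
    refine ⟨max a b, fun m hm => ?_⟩
    by_cases hf : MvPowerSeries.coeff m f = 0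
    · have hg : MvPowerSeries.coeff m g ≠ 0 := by
        intro h
        simp [hf, h] at hm
      exact (hb m hg).trans (le_max_right _ _)
    · exact (ha m hf).trans (le_max_left _ _)
  algebraMap_mem' := by
    intro c
    refine ⟨0, fun m hm => ?_⟩
    classical
    rw [MvPowerSeries.algebraMap_apply, MvPowerSeries.coeff_C] at hm
    by_cases h : m = 0
    · simp [h]
    · simp [h] at hm

variable {K : Type*} [Field K]

/-- The support of a formal polynomial: the set of monomials with nonzero coefficient. -/
def supp (f : RP K) : Set (ℕ →₀ ℕ) :=
  {m | MvPowerSeries.coeff m (f : MvPowerSeries ℕ K) ≠ 0}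

/-- The monomial with exponent vector `m`, as an element of `RP K`. -/
def mon (K : Type*) [Field K] (m : ℕ →₀ ℕ) : RP K :=
  ⟨MvPowerSeries.monomial m 1, m.degree, fun m' hm' => by
    classical
    rw [MvPowerSeries.coeff_monomial] at hm'
    by_cases h : m' = m
    · rw [h]
    · simp [h] at hm'⟩

/-- Monomial ideals: ideals of `RP K` generated by a set of monomials. -/
def IsMonomialIdeal (J : Ideal (RP K)) : Prop :=
  ∃ S : Set (ℕ →₀ ℕ), J = Ideal.span (mon K '' S)

/-- `f` is homogeneous of total degree `d` (the zero element is homogeneous of every degree). -/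
def IsHomogeneousOfDegree (f : RP K) (d : ℕ) : Prop :=
  ∀ m ∈ supp f, m.degree = d

/-- Locally finitely generated ideals: those generated by a union `⋃_{d ≥ 1} F_d` of finite sets
`F_d` of homogeneous elements of total degree `d`. -/
def IsLFG (I : Ideal (RP K)) : Prop :=
  ∃ F : ℕ → Set (RP K),
    (∀ d, 1 ≤ d → (F d).Finite ∧ ∀ f ∈ F d, IsHomogeneousOfDegree f d) ∧
    I = Ideal.span (⋃ d ∈ Set.Ici 1, F d)

/-! Term orders and initial ideals. -/

/-- `lt` is (the strict version of) a multiplicative total order on the monomials whose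
restriction to the variables is order-isomorphic to `-ω`. -/
structure IsTermOrder (lt : (ℕ →₀ ℕ) → (ℕ →₀ ℕ) → Prop) : Prop where
  isStrictTotalOrder : IsStrictTotalOrder (ℕ →₀ ℕ) lt
  mul_right : ∀ a b c : ℕ →₀ ℕ, lt a b → lt (a + c) (b + c)
  order_variables : Nonempty ((fun i j : ℕ => lt (Finsupp.single i 1) (Finsupp.single j 1)) ≃r
    ((· > ·) : ℕ → ℕ → Prop))

/-- `m` is the initial monomial of `f`: the largest element of its support. -/
def IsInitialMonomial (lt : (ℕ →₀ ℕ) → (ℕ →₀ ℕ) → Prop) (f : RP K) (m : ℕ →₀ ℕ) : Prop :=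
  m ∈ supp f ∧ ∀ m' ∈ supp f, m' ≠ m → lt m' m

/-- The initial ideal: the ideal of `RP K` generated by the initial monomials of the elements
of `I`. -/
def initialIdeal (lt : (ℕ →₀ ℕ) → (ℕ →₀ ℕ) → Prop) (I : Ideal (RP K)) : Ideal (RP K) :=
  Ideal.span (mon K '' {m | ∃ f ∈ I, IsInitialMonomial lt f m})

/-! The multi-grading attached to a partition of the variables into `r` blocks, given by the map
`y` that sends the index of a variable to the index of its block. -/

/-- The multi-degree homomorphism: `x_i ↦ e_{y(i)}`. -/
def multideg {r : ℕ} (y : ℕ → Fin r) : (ℕ →₀ ℕ) →+ (Fin r →₀ ℕ) :=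
  Finsupp.weight (fun i => Finsupp.single (y i) 1)

/-- The component of `f` of multi-degree `α`. -/
def component {r : ℕ} (y : ℕ → Fin r) (α : Fin r →₀ ℕ) (f : RP K) : RP K :=
  open Classical in
  ⟨fun m => if multideg y m = α then MvPowerSeries.coeff m (f : MvPowerSeries ℕ K) else 0, by
    obtain ⟨d, hd⟩ := f.2
    refine ⟨d, fun m hm => hd m fun h => hm ?_⟩
    change (if multideg y m = α then MvPowerSeries.coeff m (f : MvPowerSeries ℕ K) else 0) = 0
    simp [h]⟩

/-- `r`-homogeneous ideals: ideals containing all multi-graded components of their elements. -/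
def IsRHomogeneous {r : ℕ} (y : ℕ → Fin r) (I : Ideal (RP K)) : Prop :=
  ∀ f ∈ I, ∀ α : Fin r →₀ ℕ, component y α f ∈ I

/-! Truncations, Hilbert series, Hilbert numerators. -/

/-- Setting the variables `x_i`, `i ≥ n`, to zero turns an element of `RP K` into a polynomial. -/
theorem killCompl_mem_range (n : ℕ) (f : RP K) :
    MvPowerSeries.killCompl (R := K) Fin.valEmbedding (f : MvPowerSeries ℕ K) ∈
      (MvPolynomial.coeToMvPowerSeries.algHom (σ := Fin n) (R := K) K).range := by
  obtain ⟨d, hd⟩ := f.2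
  let g : MvPowerSeries (Fin n) K :=
    MvPowerSeries.killCompl (R := K) Fin.valEmbedding (f : MvPowerSeries ℕ K)
  have hg : ∀ m : Fin n →₀ ℕ, MvPowerSeries.coeff m g ≠ 0 → m ≤ Finsupp.equivFunOnFinite.symm
      (fun _ => d) := by
    intro m hm i
    have h := hd (m.embDomain Fin.valEmbedding) (by
      rwa [← MvPowerSeries.coeff_killCompl])
    rw [Finsupp.embDomain_eq_mapDomain, Finsupp.degree_mapDomain] at h
    exact (Finsupp.le_degree i m).trans h
  refine ⟨MvPowerSeries.trunc' K (Finsupp.equivFunOnFinite.symm (fun _ => d)) g, ?_⟩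
  change _ = g
  ext m
  change MvPowerSeries.coeff m (MvPolynomial.coeToMvPowerSeries.algHom (σ := Fin n) (R := K) K
    (MvPowerSeries.trunc' K (Finsupp.equivFunOnFinite.symm (fun _ => d)) g)) = _
  rw [MvPolynomial.coeToMvPowerSeries.algHom_apply, Algebra.algebraMap_self,
    MvPowerSeries.map_id, RingHom.id_apply, MvPolynomial.coeff_coe, MvPowerSeries.coeff_trunc']
  split_ifs with h
  · rfl
  · by_contra h'
    exact h (hg m (Ne.symm h'))

theorem coe_injective (K : Type*) [Field K] (n : ℕ) : Function.Injective
    (MvPolynomial.coeToMvPowerSeries.algHom (σ := Fin n) (R := K) K) := by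
  intro p q h
  simpa using h

/-- The truncation homomorphism `ρ_n : RP K → K[x_0, …, x_{n-1}]`, which kills all monomials
involving a variable `x_i` with `i ≥ n` and fixes the other monomials. -/
def restr (n : ℕ) : RP K →ₐ[K] MvPolynomial (Fin n) K :=
  ((AlgEquiv.ofInjective _ (coe_injective K n)).symm : _ →ₐ[K] MvPolynomial (Fin n) K).comp
  (((MvPowerSeries.killCompl (R := K) (Fin.valEmbedding (n := n))).comp (RP K).val).codRestrict
    _ (killCompl_mem_range n))

theorem coe_restr (n : ℕ) (f : RP K) :
    (restr n f : MvPowerSeries (Fin n) K) =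
      MvPowerSeries.killCompl (R := K) Fin.valEmbedding (f : MvPowerSeries ℕ K) := by
  have h : MvPolynomial.coeToMvPowerSeries.algHom (σ := Fin n) (R := K) K (restr n f) =
      MvPowerSeries.killCompl (R := K) Fin.valEmbedding (f : MvPowerSeries ℕ K) :=
    congrArg Subtype.val (AlgEquiv.apply_symm_apply (AlgEquiv.ofInjective _ (coe_injective K n))
      (((MvPowerSeries.killCompl (R := K) (Fin.valEmbedding (n := n))).comp
        (RP K).val).codRestrict _ (killCompl_mem_range n) f))
  rwa [MvPolynomial.coeToMvPowerSeries.algHom_apply, Algebra.algebraMap_self,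
    MvPowerSeries.map_id, RingHom.id_apply] at h

theorem coeff_restr (n : ℕ) (f : RP K) (m : Fin n →₀ ℕ) :
    MvPolynomial.coeff m (restr n f) =
      MvPowerSeries.coeff (m.embDomain Fin.valEmbedding) (f : MvPowerSeries ℕ K) := by
  rw [← MvPolynomial.coeff_coe, coe_restr, MvPowerSeries.coeff_killCompl]

/-- The homogeneous component of multi-degree `α` of the quotient `K[x_0, …, x_{n-1}] / J`: the
image of the space of polynomials of multi-degree `α`. -/
def quotientComponent {r : ℕ} (y : ℕ → Fin r) {n : ℕ} (J : Ideal (MvPolynomial (Fin n) K))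
    (α : Fin r →₀ ℕ) : Submodule K (MvPolynomial (Fin n) K ⧸ J) :=
  (MvPolynomial.weightedHomogeneousSubmodule K
    (fun i : Fin n => Finsupp.single (y i) 1) α).map (Ideal.Quotient.mkₐ K J).toLinearMap

/-- The multi-graded Hilbert series of `K[x_0, …, x_{n-1}] / J`. -/
def hilbertSeries {r : ℕ} (y : ℕ → Fin r) {n : ℕ} (J : Ideal (MvPolynomial (Fin n) K)) :
    MvPowerSeries (Fin r) ℤ :=
  fun α => (Module.finrank K (quotientComponent y J α) : ℤ)

/-- The series `g_n` such that `g_n / ∏_{i < n} (1 - t_{y(i)})` is the multi-graded Hilbert series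
of `K[x_0, …, x_{n-1}] / ρ_n(I)`. As `ρ_n` is surjective, `ρ_n(I)` is an ideal. -/
def truncatedNumerator {r : ℕ} (y : ℕ → Fin r) (I : Ideal (RP K)) (n : ℕ) :
    MvPowerSeries (Fin r) ℤ :=
  hilbertSeries y (I.map (restr (K := K) n)) * ∏ i : Fin n, (1 - MvPowerSeries.X (y i))

/-- `g` is the `r`-graded Hilbert numerator of `I`: the limit of the `g_n` in the
`(t_1, …, t_r)`-adic topology of `ℤ[[t_1, …, t_r]]`. -/
def IsHilbertNumerator {r : ℕ} (y : ℕ → Fin r) (I : Ideal (RP K))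
    (g : MvPowerSeries (Fin r) ℤ) : Prop :=
  ∀ d : ℕ, ∃ N : ℕ, ∀ n ≥ N, ∀ α : Fin r →₀ ℕ, α.degree ≤ d →
    MvPowerSeries.coeff α (truncatedNumerator y I n) = MvPowerSeries.coeff α g

theorem IsHilbertNumerator.unique {r : ℕ} {y : ℕ → Fin r} {I : Ideal (RP K)}
    {g h : MvPowerSeries (Fin r) ℤ} (hg : IsHilbertNumerator y I g)
    (hh : IsHilbertNumerator y I h) : g = h := by
  ext α
  obtain ⟨N, hN⟩ := hg α.degree
  obtain ⟨M, hM⟩ := hh α.degree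
  rw [← hN (max N M) (le_max_left _ _) α le_rfl, ← hM (max N M) (le_max_right _ _) α le_rfl]

/-! The `[X]`-graded Hilbert numerator of a monomial ideal, and the collapsing map. -/

/-- The `[X]`-graded Hilbert series `q(J)` of a monomial ideal `J`: the sum of all monomials
outside `J`. -/
def qSeries (J : Ideal (RP K)) : MvPowerSeries ℕ ℤ :=
  open Classical in fun m => if mon K m ∈ J then 0 else 1

/-- The Möbius series `μ = ∏ (1 - x_i)`. -/
def mobius : MvPowerSeries ℕ ℤ :=
  open Classical in fun m => if ∀ i, m i ≤ 1 then (-1) ^ m.degree else 0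

/-- The `[X]`-graded Hilbert numerator `p(J) = μ q(J)` of a monomial ideal `J`. -/
def pSeries (J : Ideal (RP K)) : MvPowerSeries ℕ ℤ :=
  mobius * qSeries J

/-- The series all of whose components of fixed total degree are polynomials; these are the
series into which one can substitute `t_{y(i)}` for `x_i`. -/
def IsCollapsible (f : MvPowerSeries ℕ ℤ) : Prop :=
  ∀ d : ℕ, {m : ℕ →₀ ℕ | m.degree = d ∧ MvPowerSeries.coeff m f ≠ 0}.Finite

/-- The substitution of `t_{y(i)}` for `x_i` in a collapsible series. -/
def collapse {r : ℕ} (y : ℕ → Fin r) (f : MvPowerSeries ℕ ℤ) : MvPowerSeries (Fin r) ℤ :=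
  fun α => ∑ᶠ m ∈ {m : ℕ →₀ ℕ | multideg y m = α}, MvPowerSeries.coeff m f

end LargePoly

end

/-!
Let `I` be an `r`-homogeneous, locally finitely generated ideal, and fix a term order. The variables
decrease, so Dickson's lemma shows that within one total degree every nonempty set of monomials has
a largest element (`IsTermOrder.wellFounded_before`). Therefore reduction steps can be performed
from the largest monomial downwards, by well-founded recursion, although supports are infinite:
this is the division theorem `exists_division`, stated for vectors so that it covers both division
by elements of `I` and division by syzygies.

That the initial ideal is locally finitely generated is Buchberger's criterion, in degree `d`
(`finite_minimalInitial_step`). Suppose that there are finitely many minimal initial monomials of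
smaller degree, and choose elements of `I` with these initial monomials. Their `S`-pairs of degree
less than `d` reduce to zero, which gives finitely many syzygies; and dividing by these syzygies
writes every element of `I` of degree `d`, up to the finitely many generators and `S`-pairs of
degree `d`, as a combination whose leading terms do not cancel. So only finitely many minimal
initial monomials of degree `d` are new.

The minimal initial monomials of degree at most `d` hence involve only the first `N` variables, for
some `N`. For `n ≥ N`, a standard representation of an element of degree at most `d` remains one
after truncation to the first `n` variables, because the initial monomials of the divisors survive.
So the monomials outside the initial ideal form a basis of the truncated quotient in these degrees,
and the Hilbert function counts them (`coeff_hilbertSeries`). Multiplication by `∏ (1 - x_i)` turns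
their generating function into the truncation of `p(in I)`, in which no monomial of degree at most
`d` involves a variable `x_i` with `i ≥ N` (`coeff_pSeries_eq_zero`, a sign-reversing involution).
Substitution of `t_{y(i)}` for `x_i` yields the Hilbert numerator (`isHilbertNumerator_collapse`).

A monomial ideal is its own initial ideal, so the same result applied to `in I`, and to any locally
finitely generated monomial ideal with the lexicographic order, gives the remaining claims.
-/

noncomputable section

namespace LargePoly

variable {K : Type*} [Field K]

/-! ### Coefficients of formal polynomials -/

/-- The coefficient of a formal polynomial at a monomial, as a linear functional. -/
def cf (m : ℕ →₀ ℕ) : RP K →ₗ[K] K :=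
  MvPowerSeries.coeff m ∘ₗ (RP K).val.toLinearMap

theorem mem_supp {f : RP K} {m : ℕ →₀ ℕ} : m ∈ supp f ↔ cf m f ≠ 0 := Iff.rfl

theorem ext_cf {f g : RP K} (h : ∀ m, cf m f = cf m g) : f = g :=
  Subtype.ext (MvPowerSeries.ext h)

theorem cf_mul (m : ℕ →₀ ℕ) (f g : RP K) :
    cf m (f * g) = ∑ x ∈ Finset.HasAntidiagonal.antidiagonal m, cf x.1 f * cf x.2 g := by
  change MvPowerSeries.coeff m ((f : MvPowerSeries ℕ K) * (g : MvPowerSeries ℕ K)) = _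
  rw [MvPowerSeries.coeff_mul]
  rfl

theorem cf_mon (m n : ℕ →₀ ℕ) : cf m (mon K n) = if m = n then 1 else 0 := by
  change MvPowerSeries.coeff m (MvPowerSeries.monomial n (1 : K)) = _
  classical
  rw [MvPowerSeries.coeff_monomial]

theorem cf_mon_mul (u m : ℕ →₀ ℕ) (f : RP K) : cf (u + m) (mon K u * f) = cf m f := by
  change MvPowerSeries.coeff (u + m) (MvPowerSeries.monomial u (1 : K) * (f : MvPowerSeries ℕ K)) = _
  rw [MvPowerSeries.coeff_add_monomial_mul, one_mul]
  rfl

theorem exists_of_cf_mul_ne_zero {m : ℕ →₀ ℕ} {f g : RP K} (h : cf m (f * g) ≠ 0) :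
    ∃ u v, u + v = m ∧ cf u f ≠ 0 ∧ cf v g ≠ 0 := by
  rw [cf_mul] at h
  obtain ⟨x, hx, hne⟩ := Finset.exists_ne_zero_of_sum_ne_zero h
  exact ⟨x.1, x.2, Finset.HasAntidiagonal.mem_antidiagonal.1 hx, left_ne_zero_of_mul hne,
    right_ne_zero_of_mul hne⟩

theorem exists_of_cf_mon_mul_ne_zero {m u : ℕ →₀ ℕ} {f : RP K} (h : cf m (mon K u * f) ≠ 0) :
    ∃ v, u + v = m ∧ cf v f ≠ 0 := by
  obtain ⟨u', v, rfl, h1, h2⟩ := exists_of_cf_mul_ne_zero h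
  rw [cf_mon] at h1
  have : u' = u := by
    by_contra h
    simp [h] at h1
  exact ⟨v, by rw [this], h2⟩

theorem mon_add (u v : ℕ →₀ ℕ) : mon K (u + v) = mon K u * mon K v := by
  apply Subtype.ext
  change MvPowerSeries.monomial (u + v) (1 : K) =
    MvPowerSeries.monomial u (1 : K) * MvPowerSeries.monomial v (1 : K)
  rw [MvPowerSeries.monomial_mul_monomial, one_mul]

theorem exists_degree_bound {ι : Type*} [Fintype ι] (q : ι → RP K) :
    ∃ d : ℕ, ∀ i m, cf m (q i) ≠ 0 → m.degree ≤ d := by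
  choose d hd using fun i => (q i).2
  exact ⟨Finset.univ.sup d, fun i m hm => (hd i m hm).trans (Finset.le_sup (Finset.mem_univ i))⟩

/-- The formal polynomial with prescribed coefficients that vanish in large degrees. -/
def ofCoeff (c : (ℕ →₀ ℕ) → K) (h : ∃ d : ℕ, ∀ m, c m ≠ 0 → m.degree ≤ d) : RP K :=
  ⟨fun m => c m, h⟩

theorem cf_ofCoeff (c : (ℕ →₀ ℕ) → K) (h) (m : ℕ →₀ ℕ) : cf m (ofCoeff c h) = c m := rfl

/-! ### Division -/

open Relation in
/-- Division in a free module of finite rank over the ring of formal polynomials. A position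
`(i, m)` stands for the monomial `m` in the `i`-th coordinate, and `rel p p'` says that `p` has
to be treated before `p'`. The vector `σ j` has its leading term, of coefficient `1`, at position
`(i₀ j, m₀ j)`. As `rel` is well-founded, the coefficients of the quotients `A j` can be chosen
one position after the other, so that the remainder vanishes at all multiples of the leading
positions. For each position only one of the `A j` is used; and positions that cannot be reached
from the support of `q` are not used. The weights `w` guarantee that the degrees stay bounded. -/
theorem exists_division {ι J : Type*} [Fintype ι] [Fintype J]
    (rel : ι × (ℕ →₀ ℕ) → ι × (ℕ →₀ ℕ) → Prop) (hwf : WellFounded rel)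
    (w : ι → ℕ) (hw : ∀ p p', rel p p' → p.2.degree + w p.1 = p'.2.degree + w p'.1)
    (σ : J → ι → RP K) (i₀ : J → ι) (m₀ : J → ℕ →₀ ℕ)
    (hlead : ∀ j, cf (m₀ j) (σ j (i₀ j)) = 1)
    (hrel : ∀ j i u v, cf u (σ j i) ≠ 0 → (i, u) ≠ (i₀ j, m₀ j) → rel (i₀ j, v + m₀ j) (i, v + u))
    (q : ι → RP K) :
    ∃ A : J → RP K,
      (∀ j v, cf v (A j) ≠ 0 →
        ∃ i u, cf u (q i) ≠ 0 ∧ ReflTransGen rel (i, u) (i₀ j, v + m₀ j)) ∧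
      (∀ j j' v v', cf v (A j) ≠ 0 → cf v' (A j') ≠ 0 →
        (i₀ j, v + m₀ j) = (i₀ j', v' + m₀ j') → j = j') ∧
      ∀ j v, cf (v + m₀ j) (q (i₀ j) - ∑ j', A j' * σ j' (i₀ j)) = 0 := by
  classical
  -- `ch p` selects one of the vectors whose leading position divides `p`.
  let ch : ι × (ℕ →₀ ℕ) → Option J := fun p =>
    if h : ∃ j v, (i₀ j, v + m₀ j) = p then some h.choose else none
  have hch : ∀ j v, ∃ j' v', ch (i₀ j, v + m₀ j) = some j' ∧
      (i₀ j', v' + m₀ j') = (i₀ j, v + m₀ j) := by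
    intro j v
    have h : ∃ j' v', (i₀ j', v' + m₀ j') = (i₀ j, v + m₀ j) := ⟨j, v, rfl⟩
    exact ⟨h.choose, h.choose_spec.choose, dif_pos h, h.choose_spec.choose_spec⟩
  -- `a p` is the coefficient that remains at `p` once all earlier positions have been treated.
  let a : ι × (ℕ →₀ ℕ) → K := hwf.fix fun p rec =>
    cf p.2 (q p.1) - ∑ j, ∑ x ∈ Finset.HasAntidiagonal.antidiagonal p.2,
      if h : rel (i₀ j, x.1 + m₀ j) p then
        (if ch (i₀ j, x.1 + m₀ j) = some j then rec _ h else 0) * cf x.2 (σ j p.1) else 0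
  let b : J → (ℕ →₀ ℕ) → K := fun j v =>
    if ch (i₀ j, v + m₀ j) = some j then a (i₀ j, v + m₀ j) else 0
  have ha : ∀ p, a p = cf p.2 (q p.1) - ∑ j, ∑ x ∈ Finset.HasAntidiagonal.antidiagonal p.2,
      if rel (i₀ j, x.1 + m₀ j) p then b j x.1 * cf x.2 (σ j p.1) else 0 := by
    intro p
    change hwf.fix _ p = _
    rw [hwf.fix_eq]
    simp only [dite_eq_ite]
    rfl
  have hb : ∀ j v, b j v ≠ 0 → ch (i₀ j, v + m₀ j) = some j ∧ a (i₀ j, v + m₀ j) ≠ 0 := by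
    intro j v h
    by_cases hc : ch (i₀ j, v + m₀ j) = some j
    · exact ⟨hc, by simpa [b, hc] using h⟩
    · simp [b, hc] at h
  have hreach : ∀ p, a p ≠ 0 → ∃ i u, cf u (q i) ≠ 0 ∧ ReflTransGen rel (i, u) p := by
    intro p
    induction p using hwf.induction with
    | _ p ih =>
      intro hp
      by_cases hq : cf p.2 (q p.1) = 0
      · rw [ha, hq, zero_sub, neg_ne_zero] at hp
        obtain ⟨j, -, hj⟩ := Finset.exists_ne_zero_of_sum_ne_zero hp
        obtain ⟨x, -, hx⟩ := Finset.exists_ne_zero_of_sum_ne_zero hj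
        by_cases hr : rel (i₀ j, x.1 + m₀ j) p
        · rw [if_pos hr] at hx
          obtain ⟨i, u, h1, h2⟩ := ih _ hr (hb _ _ (left_ne_zero_of_mul hx)).2
          exact ⟨i, u, h1, h2.tail hr⟩
        · rw [if_neg hr] at hx
          exact absurd rfl hx
      · exact ⟨p.1, p.2, hq, ReflTransGen.refl⟩
  have hdeg : ∀ p p', ReflTransGen rel p p' → p.2.degree + w p.1 = p'.2.degree + w p'.1 := by
    intro p p' h
    induction h with
    | refl => rfl
    | tail _ h ih => exact ih.trans (hw _ _ h)
  obtain ⟨d, hd⟩ := exists_degree_bound q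
  have hbdd : ∀ j, ∃ D : ℕ, ∀ m, b j m ≠ 0 → m.degree ≤ D := by
    intro j
    refine ⟨d + ∑ i, w i, fun m hm => ?_⟩
    obtain ⟨i, u, h1, h2⟩ := hreach _ (hb _ _ hm).2
    have h3 := hdeg _ _ h2
    simp only [map_add] at h3
    have h4 := hd i u h1
    have h5 : w i ≤ ∑ i, w i := Finset.single_le_sum (fun _ _ => Nat.zero_le _) (Finset.mem_univ i)
    omega
  refine ⟨fun j => ofCoeff (b j) (hbdd j), ?_, ?_, ?_⟩
  · intro j v hv
    exact hreach _ (hb _ _ hv).2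
  · intro j j' v v' h h' he
    have h1 := (hb _ _ h).1
    rw [he, (hb _ _ h').1] at h1
    exact (Option.some.inj h1).symm
  · intro j v
    set p : ι × (ℕ →₀ ℕ) := (i₀ j, v + m₀ j) with hp
    obtain ⟨j₁, v₁, hj₁, hv₁⟩ := hch j v
    rw [← hp] at hj₁ hv₁
    have hirr : ¬ rel p p := fun h => hwf.asymmetric _ _ h h
    suffices h : ∑ j', ∑ x ∈ Finset.HasAntidiagonal.antidiagonal p.2, b j' x.1 * cf x.2 (σ j' p.1) =
        a p + ∑ j', ∑ x ∈ Finset.HasAntidiagonal.antidiagonal p.2,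
          if rel (i₀ j', x.1 + m₀ j') p then b j' x.1 * cf x.2 (σ j' p.1) else 0 by
      rw [ha] at h
      rw [map_sub, map_sum, sub_eq_zero]
      change cf p.2 (q p.1) = _
      simp only [cf_mul, cf_ofCoeff]
      change _ = ∑ j', ∑ x ∈ Finset.HasAntidiagonal.antidiagonal p.2, b j' x.1 * cf x.2 (σ j' p.1)
      rw [h]
      ring
    rw [← sub_eq_iff_eq_add, ← Finset.sum_sub_distrib]
    simp only [← Finset.sum_sub_distrib]
    -- Outside the leading position, the terms that are not governed by `rel` vanish.
    have key : ∀ j' x, x ∈ Finset.HasAntidiagonal.antidiagonal p.2 → b j' x.1 * cf x.2 (σ j' p.1) -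
        (if rel (i₀ j', x.1 + m₀ j') p then b j' x.1 * cf x.2 (σ j' p.1) else 0) ≠ 0 →
        j' = j₁ ∧ x = (v₁, m₀ j₁) := by
      intro j' x hx hne
      have hx' := Finset.HasAntidiagonal.mem_antidiagonal.1 hx
      by_cases hr : rel (i₀ j', x.1 + m₀ j') p
      · simp [hr] at hne
      · rw [if_neg hr, sub_zero] at hne
        have h2 := right_ne_zero_of_mul hne
        have h3 : (p.1, x.2) = (i₀ j', m₀ j') := by
          by_contra h
          have h4 := hrel j' p.1 x.2 x.1 h2 h
          rw [hx'] at h4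
          exact hr h4
        have h5 := (hb _ _ (left_ne_zero_of_mul hne)).1
        have h6 : (i₀ j', x.1 + m₀ j') = p := by
          have h7 := (Prod.ext_iff.1 h3)
          simp only at h7
          rw [← h7.1, ← h7.2, hx']
        rw [h6, hj₁] at h5
        have h7 : j₁ = j' := Option.some.inj h5
        subst h7
        refine ⟨rfl, Prod.ext ?_ (Prod.ext_iff.1 h3).2⟩
        have h8 := (Prod.ext_iff.1 (h6.trans hv₁.symm)).2
        exact add_right_cancel h8
    have hmem : (v₁, m₀ j₁) ∈ Finset.HasAntidiagonal.antidiagonal p.2 := by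
      rw [Finset.HasAntidiagonal.mem_antidiagonal, ← hv₁]
    rw [Finset.sum_eq_single j₁, Finset.sum_eq_single (v₁, m₀ j₁)]
    · have h1 : p.1 = i₀ j₁ := by rw [← hv₁]
      simp only [hv₁, if_neg hirr, sub_zero]
      rw [h1, hlead, mul_one]
      simp only [b, hv₁, hj₁, if_true]
    · intro x hx hne
      by_contra h
      exact hne (key _ _ hx h).2
    · exact fun h => absurd hmem h
    · intro j' _ hne
      refine Finset.sum_eq_zero fun x hx => ?_
      by_contra h
      exact hne (key _ _ hx h).1
    · exact fun h => absurd (Finset.mem_univ _) h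

/-! ### Term orders -/

/-- `Before lt a b`: the monomial `a` has the same total degree as `b` and is larger. -/
def Before (lt : (ℕ →₀ ℕ) → (ℕ →₀ ℕ) → Prop) (a b : ℕ →₀ ℕ) : Prop :=
  a.degree = b.degree ∧ lt b a

namespace IsTermOrder

variable {lt : (ℕ →₀ ℕ) → (ℕ →₀ ℕ) → Prop}

theorem irrefl (hlt : IsTermOrder lt) (a : ℕ →₀ ℕ) : ¬ lt a a :=
  hlt.isStrictTotalOrder.irrefl a

theorem trans (hlt : IsTermOrder lt) {a b c : ℕ →₀ ℕ} : lt a b → lt b c → lt a c :=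
  hlt.isStrictTotalOrder.trans a b c

theorem trichotomy (hlt : IsTermOrder lt) (a b : ℕ →₀ ℕ) : lt a b ∨ a = b ∨ lt b a := by
  have := hlt.isStrictTotalOrder
  exact trichotomous_of lt a b

theorem add_left (hlt : IsTermOrder lt) (c : ℕ →₀ ℕ) {a b : ℕ →₀ ℕ} (h : lt a b) :
    lt (c + a) (c + b) := by
  rw [add_comm c, add_comm c]
  exact hlt.mul_right _ _ _ h

/-- A multiplicative order is compatible with replacing the variables of a product by smaller
ones. -/
theorem sum_single_le (hlt : IsTermOrder lt) {τ : ℕ → ℕ}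
    (hτ : ∀ i j, i ≤ j → τ i = τ j ∨ lt (Finsupp.single (τ j) 1) (Finsupp.single (τ i) 1))
    {ι : Type*} (s : Finset ι) {f g : ι → ℕ} (h : ∀ i, f i ≤ g i) :
    ∑ i ∈ s, Finsupp.single (τ (g i)) 1 = ∑ i ∈ s, Finsupp.single (τ (f i)) 1 ∨
      lt (∑ i ∈ s, Finsupp.single (τ (g i)) 1) (∑ i ∈ s, Finsupp.single (τ (f i)) 1) := by
  classical
  induction s using Finset.induction_on with
  | empty => simp
  | insert a s ha ih =>
    rw [Finset.sum_insert ha, Finset.sum_insert ha]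
    rcases hτ _ _ (h a) with h1 | h1
    · rw [h1]
      rcases ih with ih | ih
      · exact Or.inl (by rw [ih])
      · exact Or.inr (hlt.add_left _ ih)
    · rcases ih with ih | ih
      · rw [ih]
        exact Or.inr (hlt.mul_right _ _ _ h1)
      · exact Or.inr (hlt.trans (hlt.mul_right _ _ _ h1) (hlt.add_left _ ih))

theorem exists_sum_single (m : ℕ →₀ ℕ) :
    ∃ f : Fin m.degree → ℕ, m = ∑ i, Finsupp.single (f i) 1 := by
  suffices h : ∀ d, ∀ m : ℕ →₀ ℕ, m.degree = d → ∃ f : Fin d → ℕ, m = ∑ i, Finsupp.single (f i) 1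
    from h _ m rfl
  intro d
  induction d with
  | zero =>
    intro m hm
    rw [Finsupp.degree_eq_zero_iff] at hm
    exact ⟨Fin.elim0, by simp [hm]⟩
  | succ d ih =>
    intro m hm
    have hne : m ≠ 0 := by
      rintro rfl
      simp at hm
    obtain ⟨i, hi⟩ := Finsupp.ne_iff.1 hne
    have hle : Finsupp.single i 1 ≤ m := by
      rw [Finsupp.single_le_iff]
      exact Nat.one_le_iff_ne_zero.2 hi
    have hdeg : (m - Finsupp.single i 1).degree = d := by
      have h := congrArg Finsupp.degree (tsub_add_cancel_of_le hle)
      rw [map_add, Finsupp.degree_single] at h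
      omega
    obtain ⟨f, hf⟩ := ih _ hdeg
    refine ⟨Fin.cons i f, ?_⟩
    rw [Fin.sum_univ_succ]
    simp only [Fin.cons_zero, Fin.cons_succ]
    rw [← hf, add_tsub_cancel_of_le hle]

/-- Within one degree, every nonempty set of monomials has a largest element. The products of
`d` variables are indexed by `Fin d → ℕ`, which is well-quasi-ordered by Dickson's lemma, and
larger tuples give smaller monomials. -/
theorem wellFounded_before (hlt : IsTermOrder lt) : WellFounded (Before lt) := by
  rw [wellFounded_iff_isEmpty_descending_chain]
  refine ⟨fun ⟨m, hm⟩ => ?_⟩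
  have hdeg : ∀ n, (m n).degree = (m 0).degree := by
    intro n
    induction n with
    | zero => rfl
    | succ n ih => exact (hm n).1.trans ih
  have hmono : ∀ k n, k < n → lt (m k) (m n) := by
    intro k n hkn
    induction n, hkn using Nat.le_induction with
    | base => exact (hm k).2
    | succ n _ ih => exact hlt.trans ih (hm n).2
  obtain ⟨e⟩ := hlt.order_variables
  have hτ : ∀ i j, i ≤ j → e.symm i = e.symm j ∨
      lt (Finsupp.single (e.symm j) 1) (Finsupp.single (e.symm i) 1) := by
    intro i j hij
    rcases hij.eq_or_lt with h | h
    · exact Or.inl (by rw [h])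
    · exact Or.inr (e.symm.map_rel_iff.2 h)
  have hf : ∀ n, ∃ f : Fin (m 0).degree → ℕ, m n = ∑ i, Finsupp.single (e.symm (f i)) 1 := by
    intro n
    have h := exists_sum_single (m n)
    rw [hdeg n] at h
    obtain ⟨f, hf⟩ := h
    exact ⟨fun i => e (f i), by simpa using hf⟩
  choose f hf using hf
  obtain ⟨k, n, hkn, hle⟩ := wellQuasiOrdered_le f
  have h := hlt.sum_single_le hτ Finset.univ hle
  rw [← hf, ← hf] at h
  rcases h with h | h
  · have := hmono k n hkn
    rw [h] at this
    exact hlt.irrefl _ this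
  · exact hlt.irrefl _ (hlt.trans (hmono k n hkn) h)

end IsTermOrder

/-! ### Initial monomials and standard representations -/

/-- The set of initial monomials of the elements of `I`. -/
def initialMonomials (lt : (ℕ →₀ ℕ) → (ℕ →₀ ℕ) → Prop) (I : Ideal (RP K)) : Set (ℕ →₀ ℕ) :=
  {m | ∃ f ∈ I, IsInitialMonomial lt f m}

/-- `g` is homogeneous with initial monomial `t`, and the coefficient of `t` is `1`. -/
def HasLead (lt : (ℕ →₀ ℕ) → (ℕ →₀ ℕ) → Prop) (g : RP K) (t : ℕ →₀ ℕ) : Prop :=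
  cf t g = 1 ∧ ∀ m, cf m g ≠ 0 → m ≠ t → Before lt t m

theorem HasLead.degree_eq {lt : (ℕ →₀ ℕ) → (ℕ →₀ ℕ) → Prop} {g : RP K} {t m : ℕ →₀ ℕ}
    (h : HasLead lt g t) (hm : cf m g ≠ 0) : m.degree = t.degree := by
  by_cases hmt : m = t
  · rw [hmt]
  · exact (h.2 m hm hmt).1.symm

theorem degree_multideg {r : ℕ} (y : ℕ → Fin r) (m : ℕ →₀ ℕ) :
    (multideg y m).degree = m.degree := by
  rw [multideg, Finsupp.weight_apply, Finsupp.sum, map_sum, Finsupp.degree_apply]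
  exact Finset.sum_congr rfl fun i _ => by simp

theorem cf_component {r : ℕ} (y : ℕ → Fin r) (α : Fin r →₀ ℕ) (f : RP K) (m : ℕ →₀ ℕ) :
    cf m (component y α f) = open Classical in if multideg y m = α then cf m f else 0 := rfl

section

variable {lt : (ℕ →₀ ℕ) → (ℕ →₀ ℕ) → Prop}

theorem IsInitialMonomial.eq (hlt : IsTermOrder lt) {f : RP K} {m m' : ℕ →₀ ℕ}
    (h : IsInitialMonomial lt f m) (h' : IsInitialMonomial lt f m') : m = m' := by
  by_contra hne
  exact hlt.irrefl _ (hlt.trans (h.2 m' h'.1 (Ne.symm hne)) (h'.2 m h.1 hne))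

theorem exists_hasLead {r : ℕ} (y : ℕ → Fin r) {I : Ideal (RP K)} (hI : IsRHomogeneous y I)
    {t : ℕ →₀ ℕ} (ht : t ∈ initialMonomials lt I) : ∃ g ∈ I, HasLead lt g t := by
  classical
  obtain ⟨f, hf, h1, h2⟩ := ht
  have h1' : cf t f ≠ 0 := h1
  refine ⟨(cf t f)⁻¹ • component y (multideg y t) f, ?_, ?_, ?_⟩
  · exact Submodule.smul_of_tower_mem I _ (hI f hf _)
  · rw [map_smul, cf_component, if_pos rfl, smul_eq_mul, inv_mul_cancel₀ h1']
  · intro m hm hne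
    rw [map_smul, cf_component, smul_eq_mul] at hm
    have hm' := right_ne_zero_of_mul hm
    split_ifs at hm' with h
    · refine ⟨?_, h2 m hm' hne⟩
      rw [← degree_multideg y t, ← h, degree_multideg]
    · exact absurd rfl hm'

theorem exists_hasLead_family {r : ℕ} (y : ℕ → Fin r) {I : Ideal (RP K)}
    (hI : IsRHomogeneous y I) :
    ∃ g : (ℕ →₀ ℕ) → RP K, ∀ t ∈ initialMonomials lt I, g t ∈ I ∧ HasLead lt (g t) t := by
  have hex : ∀ t, ∃ g : RP K, t ∈ initialMonomials lt I → g ∈ I ∧ HasLead lt g t := by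
    intro t
    by_cases ht : t ∈ initialMonomials lt I
    · obtain ⟨g, h1, h2⟩ := exists_hasLead y hI ht
      exact ⟨g, fun _ => ⟨h1, h2⟩⟩
    · exact ⟨0, fun h => absurd h ht⟩
  exact ⟨fun t => (hex t).choose, fun t => (hex t).choose_spec⟩

theorem add_mem_initialMonomials (hlt : IsTermOrder lt) {I : Ideal (RP K)} {t : ℕ →₀ ℕ}
    (ht : t ∈ initialMonomials lt I) (u : ℕ →₀ ℕ) : u + t ∈ initialMonomials lt I := by
  obtain ⟨f, hf, h1, h2⟩ := ht
  refine ⟨mon K u * f, I.mul_mem_left _ hf, ?_, fun m hm hne => ?_⟩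
  · rw [mem_supp, cf_mon_mul]
    exact h1
  · obtain ⟨v, rfl, hv⟩ := exists_of_cf_mon_mul_ne_zero hm
    exact hlt.add_left _ (h2 v hv fun h => hne (by rw [h]))

theorem exists_isInitialMonomial (hlt : IsTermOrder lt) {f : RP K} {d : ℕ} (hf : f ≠ 0)
    (hd : ∀ m, cf m f ≠ 0 → m.degree = d) : ∃ m, IsInitialMonomial lt f m := by
  have hne : {m | cf m f ≠ 0}.Nonempty := by
    by_contra h
    rw [Set.not_nonempty_iff_eq_empty] at h
    refine hf (ext_cf fun m => ?_)
    have : m ∉ {m | cf m f ≠ 0} := by rw [h]; exact id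
    simpa using this
  obtain ⟨m, hm, hmin⟩ := hlt.wellFounded_before.has_min _ hne
  refine ⟨m, hm, fun m' hm' hne => ?_⟩
  rcases hlt.trichotomy m' m with h | h | h
  · exact h
  · exact absurd h hne
  · exact absurd ⟨by rw [hd _ hm, hd _ hm'], h⟩ (hmin m' hm')

/-- If the monomials `u + ℓ i`, for `u` in the support of `q i`, are pairwise distinct, then the
largest of them is the initial monomial of `∑ q i * g i`. The statement is relative to a set `S`
of monomials, such as the monomials in the first `n` variables; this yields the initial
monomials of truncations. -/
theorem exists_initial_of_sum (hlt : IsTermOrder lt) {ι : Type*} [Fintype ι]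
    (ℓ : ι → ℕ →₀ ℕ) (g q : ι → RP K) (hg : ∀ i, HasLead lt (g i) (ℓ i)) {d : ℕ}
    (hd : ∀ i u, cf u (q i) ≠ 0 → (u + ℓ i).degree = d)
    (hinj : ∀ i j u v, cf u (q i) ≠ 0 → cf v (q j) ≠ 0 → u + ℓ i = v + ℓ j → i = j)
    (S : Set (ℕ →₀ ℕ)) (hS : ∀ u v, u + v ∈ S → u ∈ S) (hadd : ∀ i, ∀ u ∈ S, u + ℓ i ∈ S)
    {w : ℕ →₀ ℕ} (hw : w ∈ S) (hne : cf w (∑ i, q i * g i) ≠ 0) :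
    ∃ i u, cf u (q i) ≠ 0 ∧ u + ℓ i ∈ S ∧ cf (u + ℓ i) (∑ i, q i * g i) ≠ 0 ∧
      ∀ m ∈ S, cf m (∑ i, q i * g i) ≠ 0 → m ≠ u + ℓ i → lt m (u + ℓ i) := by
  classical
  have hbelow : ∀ m ∈ S, cf m (∑ i, q i * g i) ≠ 0 →
      ∃ i u, cf u (q i) ≠ 0 ∧ u + ℓ i ∈ S ∧ (m = u + ℓ i ∨ lt m (u + ℓ i)) := by
    intro m hm hne
    rw [map_sum] at hne
    obtain ⟨i, -, hi⟩ := Finset.exists_ne_zero_of_sum_ne_zero hne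
    obtain ⟨u, v, rfl, h1, h2⟩ := exists_of_cf_mul_ne_zero hi
    refine ⟨i, u, h1, hadd i u (hS _ _ hm), ?_⟩
    by_cases hv : v = ℓ i
    · exact Or.inl (by rw [hv])
    · exact Or.inr (hlt.add_left _ ((hg i).2 v h2 hv).2)
  let P : Set (ℕ →₀ ℕ) := {m | m ∈ S ∧ ∃ i u, cf u (q i) ≠ 0 ∧ m = u + ℓ i}
  have hP : P.Nonempty := by
    obtain ⟨i, u, h1, h2, -⟩ := hbelow w hw hne
    exact ⟨u + ℓ i, h2, i, u, h1, rfl⟩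
  obtain ⟨m, ⟨hmS, i, u, hu, rfl⟩, hmin⟩ := hlt.wellFounded_before.has_min P hP
  have hmax : ∀ j v, cf v (q j) ≠ 0 → v + ℓ j ∈ S → v + ℓ j = u + ℓ i ∨ lt (v + ℓ j) (u + ℓ i) := by
    intro j v hv hvS
    rcases hlt.trichotomy (v + ℓ j) (u + ℓ i) with h | h | h
    · exact Or.inr h
    · exact Or.inl h
    · exact absurd ⟨by rw [hd _ _ hv, hd _ _ hu], h⟩ (hmin _ ⟨hvS, j, v, hv, rfl⟩)
  refine ⟨i, u, hu, hmS, ?_, fun m hm hne hmne => ?_⟩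
  · have key : ∀ j, ∀ x ∈ Finset.HasAntidiagonal.antidiagonal (u + ℓ i),
        cf x.1 (q j) * cf x.2 (g j) ≠ 0 → j = i ∧ x = (u, ℓ i) := by
      intro j x hx hne
      rw [Finset.HasAntidiagonal.mem_antidiagonal] at hx
      have h1 := left_ne_zero_of_mul hne
      have h2 := right_ne_zero_of_mul hne
      have hxS : x.1 + ℓ j ∈ S := hadd j _ (hS _ x.2 (by rwa [hx]))
      have hx2 : x.2 = ℓ j := by
        by_contra h
        have h3 := hlt.add_left x.1 ((hg j).2 _ h2 h).2
        rw [hx] at h3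
        rcases hmax j x.1 h1 hxS with h4 | h4
        · rw [h4] at h3
          exact hlt.irrefl _ h3
        · exact hlt.irrefl _ (hlt.trans h3 h4)
      rw [hx2] at hx
      have hij := hinj j i _ _ h1 hu hx
      subst hij
      exact ⟨rfl, Prod.ext (add_right_cancel hx) hx2⟩
    have hmem : (u, ℓ i) ∈ Finset.HasAntidiagonal.antidiagonal (u + ℓ i) := by
      rw [Finset.HasAntidiagonal.mem_antidiagonal]
    rw [map_sum, Finset.sum_eq_single i, cf_mul, Finset.sum_eq_single (u, ℓ i)]
    · rw [(hg i).1, mul_one]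
      exact hu
    · intro x hx hne
      by_contra h
      exact hne (key i x hx h).2
    · exact fun h => absurd hmem h
    · intro j _ hne
      rw [cf_mul]
      refine Finset.sum_eq_zero fun x hx => ?_
      by_contra h
      exact hne (key j x hx h).1
    · exact fun h => absurd (Finset.mem_univ _) h
  · obtain ⟨j, v, hv, hvS, h⟩ := hbelow m hm hne
    rcases hmax j v hv hvS with h1 | h1
    · rw [h1] at h
      exact h.resolve_left hmne
    · rcases h with h | h
      · rw [h]
        exact h1
      · exact hlt.trans h h1

/-- Division of an element of degree `e` of the ideal by elements whose initial monomials generate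
all initial monomials of degree `e`. -/
theorem exists_representation (hlt : IsTermOrder lt) {I : Ideal (RP K)}
    (T : Finset (ℕ →₀ ℕ)) (g : (ℕ →₀ ℕ) → RP K) (hgI : ∀ t ∈ T, g t ∈ I)
    (hg : ∀ t ∈ T, HasLead lt (g t) t) {e : ℕ}
    (hT : ∀ m ∈ initialMonomials lt I, m.degree = e → ∃ t ∈ T, t ≤ m)
    {f : RP K} (hfI : f ∈ I) (hf : ∀ m, cf m f ≠ 0 → m.degree = e) :
    ∃ A : T → RP K, f = ∑ t, A t * g t ∧
      (∀ t v, cf v (A t) ≠ 0 → ∃ u, cf u f ≠ 0 ∧ (u = v + t ∨ Before lt u (v + t))) ∧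
      ∀ t t' u v, cf u (A t) ≠ 0 → cf v (A t') ≠ 0 → u + (t : ℕ →₀ ℕ) = v + t' → t = t' := by
  obtain ⟨A, h1, h2, h3⟩ := exists_division (ι := Unit) (J := T)
    (fun p p' => Before lt p.2 p'.2) (InvImage.wf _ hlt.wellFounded_before) (fun _ => 0)
    (fun p p' h => by rw [h.1]) (fun t _ => g t) (fun _ => ()) (fun t => t)
    (fun t => (hg t t.2).1)
    (fun t i u v hu hne => by
      have h := (hg t t.2).2 u hu (fun h => hne (by rw [h]))
      exact ⟨by rw [map_add, map_add, h.1], hlt.add_left _ h.2⟩)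
    (fun _ => f)
  have h1' : ∀ t v, cf v (A t) ≠ 0 →
      ∃ u, cf u f ≠ 0 ∧ (u = v + (t : ℕ →₀ ℕ) ∨ Before lt u (v + t)) := by
    intro t v hv
    obtain ⟨⟨⟩, u, hu, hr⟩ := h1 t v hv
    refine ⟨u, hu, ?_⟩
    have h4 : ∀ p : Unit × (ℕ →₀ ℕ), Relation.ReflTransGen
        (fun p p' : Unit × (ℕ →₀ ℕ) => Before lt p.2 p'.2) ((), u) p →
        u = p.2 ∨ Before lt u p.2 := by
      intro p hr
      induction hr with
      | refl => exact Or.inl rfl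
      | tail _ h ih =>
        rcases ih with ih | ih
        · exact Or.inr (by rwa [ih])
        · exact Or.inr ⟨ih.1.trans h.1, hlt.trans h.2 ih.2⟩
    exact h4 _ hr
  refine ⟨A, ?_, h1', fun t t' u v hu hv h => h2 t t' u v hu hv (by rw [h])⟩
  have hmem : f - ∑ t, A t * g t ∈ I :=
    I.sub_mem hfI (I.sum_mem fun t _ => I.mul_mem_left _ (hgI t t.2))
  by_contra hne
  have hdeg : ∀ m, cf m (f - ∑ t, A t * g t) ≠ 0 → m.degree = e := by
    intro m hm
    by_cases hmf : cf m f = 0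
    · rw [map_sub, hmf, zero_sub, neg_ne_zero, map_sum] at hm
      obtain ⟨t, -, ht⟩ := Finset.exists_ne_zero_of_sum_ne_zero hm
      obtain ⟨u, v, rfl, hu, hv⟩ := exists_of_cf_mul_ne_zero ht
      obtain ⟨w, hw, h⟩ := h1' t u hu
      have h5 := (hg t t.2).degree_eq hv
      have h6 := hf w hw
      rcases h with h | h
      · rw [h, map_add] at h6
        rw [map_add, h5, h6]
      · rw [h.1, map_add] at h6
        rw [map_add, h5, h6]
    · exact hf m hmf
  obtain ⟨m, hm⟩ := exists_isInitialMonomial hlt (sub_ne_zero.2 hne) hdeg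
  obtain ⟨t, ht, hle⟩ := hT m ⟨_, hmem, hm⟩ (hdeg m hm.1)
  have h6 := h3 ⟨t, ht⟩ (m - t)
  simp only [tsub_add_cancel_of_le hle] at h6
  exact hm.1 h6

end

/-! ### Homogeneous parts -/

/-- The homogeneous part of total degree `d`. -/
def homPart (d : ℕ) (f : RP K) : RP K :=
  ofCoeff (fun m => if m.degree = d then cf m f else 0)
    ⟨d, fun m hm => by
      by_contra h
      rw [if_neg (by omega)] at hm
      exact hm rfl⟩

theorem cf_homPart (d : ℕ) (f : RP K) (m : ℕ →₀ ℕ) :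
    cf m (homPart d f) = if m.degree = d then cf m f else 0 := rfl

theorem homPart_add (d : ℕ) (f g : RP K) : homPart d (f + g) = homPart d f + homPart d g := by
  refine ext_cf fun m => ?_
  simp only [map_add, cf_homPart]
  split_ifs <;> simp

theorem homPart_zero (d : ℕ) : homPart d (0 : RP K) = 0 := by
  refine ext_cf fun m => ?_
  simp [cf_homPart]

theorem homPart_of_homogeneous {d : ℕ} {f : RP K} (hf : ∀ m, cf m f ≠ 0 → m.degree = d) :
    homPart d f = f := by
  refine ext_cf fun m => ?_
  rw [cf_homPart]
  by_cases h : m.degree = d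
  · rw [if_pos h]
  · rw [if_neg h]
    by_contra h'
    exact h (hf m (Ne.symm h'))

theorem degree_eq_of_cf_homPart_ne_zero {d : ℕ} {f : RP K} {m : ℕ →₀ ℕ}
    (h : cf m (homPart d f) ≠ 0) : m.degree = d := by
  by_contra h'
  rw [cf_homPart, if_neg h'] at h
  exact h rfl

theorem homPart_mul_of_homogeneous {d k : ℕ} (c : RP K) {f : RP K}
    (hf : ∀ m, cf m f ≠ 0 → m.degree = k) :
    homPart (d + k) (c * f) = homPart d c * f := by
  refine ext_cf fun m => ?_
  rw [cf_homPart]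
  split_ifs with h
  · rw [cf_mul, cf_mul]
    refine Finset.sum_congr rfl fun x hx => ?_
    rw [Finset.HasAntidiagonal.mem_antidiagonal] at hx
    by_cases hx2 : cf x.2 f = 0
    · rw [hx2, mul_zero, mul_zero]
    · rw [cf_homPart, if_pos]
      have h2 := hf _ hx2
      rw [← hx, map_add, h2] at h
      omega
  · by_contra hne
    obtain ⟨u, v, rfl, hu, hv⟩ := exists_of_cf_mul_ne_zero (Ne.symm hne)
    rw [map_add, degree_eq_of_cf_homPart_ne_zero hu, hf _ hv] at h
    exact h rfl

theorem homPart_mul_eq_zero {d k : ℕ} (hdk : d < k) (c : RP K) {f : RP K}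
    (hf : ∀ m, cf m f ≠ 0 → m.degree = k) : homPart d (c * f) = 0 := by
  refine ext_cf fun m => ?_
  rw [map_zero]
  by_contra h
  have h1 := degree_eq_of_cf_homPart_ne_zero h
  rw [cf_homPart, if_pos h1] at h
  obtain ⟨u, v, rfl, -, hv⟩ := exists_of_cf_mul_ne_zero h
  have := hf _ hv
  rw [map_add] at h1
  omega

theorem homPart_zero_mul (c f : RP K) : homPart 0 c * f = cf 0 c • f := by
  refine ext_cf fun m => ?_
  rw [cf_mul, Finset.sum_eq_single (0, m), cf_homPart, map_smul]
  · simp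
  · intro x hx hne
    rw [Finset.HasAntidiagonal.mem_antidiagonal] at hx
    rw [cf_homPart, if_neg, zero_mul]
    rw [Finsupp.degree_eq_zero_iff]
    intro h
    exact hne (Prod.ext h (by rw [← hx, h, zero_add]))
  · intro h
    exact absurd (Finset.HasAntidiagonal.mem_antidiagonal.2 (zero_add m)) h

section

variable {lt : (ℕ →₀ ℕ) → (ℕ →₀ ℕ) → Prop}

/-! ### Syzygies of pairs -/

/-- The syzygy relation of a pair of elements of `I` whose initial monomials have a least common
multiple of small degree. -/
theorem exists_spair_representation (hlt : IsTermOrder lt) {I : Ideal (RP K)} {d : ℕ}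
    (T : Finset (ℕ →₀ ℕ)) (g : (ℕ →₀ ℕ) → RP K) (hgI : ∀ t ∈ T, g t ∈ I)
    (hg : ∀ t ∈ T, HasLead lt (g t) t)
    (hT : ∀ m ∈ initialMonomials lt I, m.degree < d → ∃ t ∈ T, t ≤ m)
    (t t' : T) (hd : ((t : ℕ →₀ ℕ) ⊔ t').degree < d) :
    ∃ A : T → RP K,
      mon K ((t : ℕ →₀ ℕ) ⊔ t' - t) * g t - mon K ((t : ℕ →₀ ℕ) ⊔ t' - t') * g t' =
        ∑ s, A s * g s ∧
      ∀ s v, cf v (A s) ≠ 0 → Before lt ((t : ℕ →₀ ℕ) ⊔ t') (v + s) := by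
  set l := (t : ℕ →₀ ℕ) ⊔ t' with hl
  have hbase : ∀ s : T, (s : ℕ →₀ ℕ) ≤ l → cf l (mon K (l - s) * g s) = 1 ∧
      ∀ m, cf m (mon K (l - s) * g s) ≠ 0 → m ≠ l → Before lt l m := by
    intro s hs
    have hl' : l - (s : ℕ →₀ ℕ) + s = l := tsub_add_cancel_of_le hs
    constructor
    · have h := cf_mon_mul (l - (s : ℕ →₀ ℕ)) s (g s)
      rw [hl'] at h
      rw [h, (hg s s.2).1]
    · intro m hm hne
      obtain ⟨v, rfl, hv⟩ := exists_of_cf_mon_mul_ne_zero hm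
      have h := (hg s s.2).2 v hv fun h => hne (by rw [h, hl'])
      rw [← hl']
      constructor
      · rw [add_tsub_cancel_right, map_add, map_add, h.1]
      · rw [add_tsub_cancel_right]
        exact hlt.add_left _ h.2
  obtain ⟨h1, h2⟩ := hbase t le_sup_left
  obtain ⟨h1', h2'⟩ := hbase t' le_sup_right
  have hsupp : ∀ m, cf m (mon K (l - t) * g t - mon K (l - t') * g t') ≠ 0 → Before lt l m := by
    intro m hm
    have hne : m ≠ l := by
      rintro rfl
      rw [map_sub, h1, h1', sub_self] at hm
      exact hm rfl
    by_cases h : cf m (mon K (l - t) * g t) = 0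
    · refine h2' m (fun h' => hm ?_) hne
      rw [map_sub, h, h', sub_self]
    · exact h2 m h hne
  obtain ⟨A, hA, hA', -⟩ := exists_representation hlt T g hgI hg (e := l.degree)
    (fun m hm hme => hT m hm (by rwa [hme]))
    (I.sub_mem (I.mul_mem_left _ (hgI t t.2)) (I.mul_mem_left _ (hgI t' t'.2)))
    (fun m hm => (hsupp m hm).1.symm)
  refine ⟨A, hA, fun s v hv => ?_⟩
  obtain ⟨u, hu, h⟩ := hA' s v hv
  have h3 := hsupp u hu
  rcases h with h | h
  · rwa [← h]
  · exact ⟨h3.1.trans h.1, hlt.trans h.2 h3.2⟩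

/-- Every homogeneous combination `∑ q t * g t` of elements whose `S`-pairs of degree less than `d`
reduce to zero can be rewritten, by division of `q` by the syzygies of these `S`-pairs, such that
the monomials `u + t` with `u` in the support of `q t` are divisible by another initial monomial
`t'` smaller than `t` only if the degree of the least common multiple of `t` and `t'` is at
least `d`. -/
theorem exists_reduced_combination (hlt : IsTermOrder lt) {I : Ideal (RP K)} {d : ℕ}
    (T : Finset (ℕ →₀ ℕ)) (g : (ℕ →₀ ℕ) → RP K) (hgI : ∀ t ∈ T, g t ∈ I)
    (hg : ∀ t ∈ T, HasLead lt (g t) t)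
    (hT : ∀ m ∈ initialMonomials lt I, m.degree < d → ∃ t ∈ T, t ≤ m)
    {e : ℕ} (q : T → RP K)
    (hq : ∀ t u, cf u (q t) ≠ 0 → (u + (t : ℕ →₀ ℕ)).degree = e) :
    ∃ q' : T → RP K, ∑ t, q' t * g t = ∑ t, q t * g t ∧
      (∀ t u, cf u (q' t) ≠ 0 → (u + (t : ℕ →₀ ℕ)).degree = e) ∧
      ∀ t u, cf u (q' t) ≠ 0 → ∀ t' : T, lt t' t → (t' : ℕ →₀ ℕ) ≤ u + t →
        d ≤ ((t : ℕ →₀ ℕ) ⊔ t').degree := by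
  classical
  let J := {p : T × T // lt p.2 p.1 ∧ ((p.1 : ℕ →₀ ℕ) ⊔ p.2).degree < d}
  have hJ : Finite J := inferInstanceAs (Finite (Subtype _))
  have : Fintype J := Fintype.ofFinite J
  choose B hB hB' using fun p : J =>
    exists_spair_representation hlt T g hgI hg hT p.1.1 p.1.2 p.2.2
  let l : J → ℕ →₀ ℕ := fun p => (p.1.1 : ℕ →₀ ℕ) ⊔ p.1.2
  have hl1 : ∀ p : J, l p - p.1.1 + (p.1.1 : ℕ →₀ ℕ) = l p :=
    fun p => tsub_add_cancel_of_le le_sup_left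
  have hl2 : ∀ p : J, l p - p.1.2 + (p.1.2 : ℕ →₀ ℕ) = l p :=
    fun p => tsub_add_cancel_of_le le_sup_right
  -- The syzygy of the pair `p`; its leading position is `(p.1.1, l p - p.1.1)`.
  let σ : J → T → RP K := fun p s =>
    (if s = p.1.1 then mon K (l p - p.1.1) else 0) -
      (if s = p.1.2 then mon K (l p - p.1.2) else 0) - B p s
  -- Positions are compared by the monomials `u + t`, and ties are broken in favour of larger `t`.
  let rel : T × (ℕ →₀ ℕ) → T × (ℕ →₀ ℕ) → Prop := fun p p' =>
    Before lt (p.2 + p.1) (p'.2 + p'.1) ∨ (p.2 + (p.1 : ℕ →₀ ℕ) = p'.2 + p'.1 ∧ lt p'.1 p.1)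
  have hrelwf : WellFounded rel := by
    have hfin : WellFounded fun s s' : T => lt s' s := by
      have : IsTrans T fun s s' : T => lt s' s := ⟨fun a b c h h' => hlt.trans h' h⟩
      have : Std.Irrefl fun s s' : T => lt s' s := ⟨fun a => hlt.irrefl _⟩
      exact Finite.wellFounded_of_trans_of_irrefl _
    have hlex : WellFounded (Prod.Lex (Before lt) fun s s' : T => lt s' s) :=
      WellFounded.prod_lex hlt.wellFounded_before hfin
    refine Subrelation.wf ?_ (InvImage.wf
      (fun p : T × (ℕ →₀ ℕ) => (p.2 + (p.1 : ℕ →₀ ℕ), p.1)) hlex)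
    rintro p p' (h | ⟨h, h'⟩)
    · exact Prod.Lex.left _ _ h
    · change Prod.Lex _ _ (_, _) (_, _)
      rw [h]
      exact Prod.Lex.right _ h'
  have hreldeg : ∀ p p', rel p p' → (p.2 + (p.1 : ℕ →₀ ℕ)).degree = (p'.2 + p'.1).degree := by
    rintro p p' (h | ⟨h, -⟩)
    · exact h.1
    · rw [h]
  have hlead : ∀ p : J, cf (l p - p.1.1) (σ p p.1.1) = 1 := by
    intro p
    have h1 : p.1.1 ≠ p.1.2 := by
      intro h
      have h' := p.2.1
      rw [← h] at h'
      exact hlt.irrefl _ h'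
    have h2 : cf (l p - p.1.1) (B p p.1.1) = 0 := by
      by_contra h
      have h' := (hB' p _ _ h).2
      rw [hl1] at h'
      exact hlt.irrefl _ h'
    simp only [σ, if_true, if_neg h1, sub_zero]
    rw [map_sub, h2, cf_mon, if_pos rfl, sub_zero]
  have hrel : ∀ (p : J) s u v, cf u (σ p s) ≠ 0 → (s, u) ≠ (p.1.1, l p - p.1.1) →
      rel (p.1.1, v + (l p - p.1.1)) (s, v + u) := by
    intro p s u v hu hne
    by_cases hBu : cf u (B p s) = 0
    · have h1 : cf u (if s = p.1.1 then mon K (l p - p.1.1) else 0) = 0 := by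
        split_ifs with hs
        · rw [cf_mon, if_neg]
          rintro rfl
          exact hne (by rw [hs])
        · rw [map_zero]
      have h2 : cf u (if s = p.1.2 then mon K (l p - p.1.2) else 0) ≠ 0 := by
        intro h
        simp only [σ, map_sub, h1, h, hBu, sub_zero] at hu
        exact hu rfl
      split_ifs at h2 with hs
      · rw [cf_mon] at h2
        have hu' : u = l p - p.1.2 := by
          by_contra h
          rw [if_neg h] at h2
          exact h2 rfl
        refine Or.inr ⟨?_, ?_⟩
        · simp only [hu', hs, add_assoc, hl1, hl2]
        · simp only [hs]
          exact p.2.1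
      · exact absurd (map_zero _) h2
    · have h := hB' p s u hBu
      refine Or.inl ?_
      simp only [add_assoc, hl1]
      exact ⟨by rw [map_add, map_add]; exact congrArg _ h.1, hlt.add_left _ h.2⟩
  obtain ⟨A, hA1, -, hA3⟩ := exists_division rel hrelwf (fun t => (t : ℕ →₀ ℕ).degree)
    (fun p p' h => by simpa only [map_add] using hreldeg p p' h)
    σ (fun p => p.1.1) (fun p => l p - p.1.1) hlead hrel q
  have hσ : ∀ p, ∑ t, σ p t * g t = 0 := by
    intro p
    simp only [σ, sub_mul, Finset.sum_sub_distrib, ite_mul, zero_mul, Finset.sum_ite_eq',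
      Finset.mem_univ, if_true]
    rw [← hB p]
    exact sub_self _
  have hAdeg : ∀ p v, cf v (A p) ≠ 0 → (v + (l p - p.1.1) + (p.1.1 : ℕ →₀ ℕ)).degree = e := by
    intro p v hv
    obtain ⟨i, u, hu, h⟩ := hA1 p v hv
    have h' : ∀ P, Relation.ReflTransGen rel (i, u) P → (P.2 + (P.1 : ℕ →₀ ℕ)).degree = e := by
      intro P hP
      induction hP with
      | refl => exact hq i u hu
      | tail _ h ih => rw [← hreldeg _ _ h, ih]
    exact h' _ h
  refine ⟨fun t => q t - ∑ p, A p * σ p t, ?_, ?_, ?_⟩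
  · simp only [sub_mul, Finset.sum_sub_distrib, Finset.sum_mul]
    rw [Finset.sum_comm]
    simp only [mul_assoc, ← Finset.mul_sum, hσ, mul_zero, Finset.sum_const_zero, sub_zero]
  · intro t u hu
    by_cases hqu : cf u (q t) = 0
    · rw [map_sub, hqu, zero_sub, neg_ne_zero, map_sum] at hu
      obtain ⟨p, -, hp⟩ := Finset.exists_ne_zero_of_sum_ne_zero hu
      obtain ⟨v, v', rfl, hv, hv'⟩ := exists_of_cf_mul_ne_zero hp
      by_cases hne : (t, v') = (p.1.1, l p - p.1.1)
      · obtain ⟨h1, h2⟩ := Prod.ext_iff.1 hne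
        simp only at h1 h2
        rw [h2, h1]
        exact hAdeg p v hv
      · rw [← hAdeg p v hv]
        exact (hreldeg _ _ (hrel p t v' v hv' hne)).symm
    · exact hq t u hqu
  · intro t u hu t' ht' hle
    by_contra hd
    rw [not_le] at hd
    have h := hA3 ⟨(t, t'), ht', hd⟩ (u - (((t : ℕ →₀ ℕ) ⊔ t') - t))
    have hle' : ((t : ℕ →₀ ℕ) ⊔ t') - t ≤ u :=
      tsub_le_iff_right.2 (sup_le le_add_self hle)
    simp only [l, tsub_add_cancel_of_le hle'] at h
    exact hu h

end

/-! ### Finiteness of the minimal initial monomials -/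

/-- A family indexed by `G` is finite if no nontrivial linear combination satisfies the finitely
many linear conditions given by vectors `h m` in a finite-dimensional space and scalars `w m e`. -/
theorem finite_of_forall_eq_zero {V G E : Type*} [AddCommGroup V] [Module K V] [Finite E]
    {S : Set V} (hS : S.Finite) (h : G → V) (hh : ∀ m, h m ∈ Submodule.span K S)
    (w : G → E → K)
    (H : ∀ c : G →₀ K, ∑ m ∈ c.support, c m • h m = 0 →
      (∀ e, ∑ m ∈ c.support, c m * w m e = 0) → c = 0) : Finite G := by
  have : FiniteDimensional K (Submodule.span K S) := FiniteDimensional.span_of_finite K hS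
  have hv : LinearIndependent K
      (fun m => ((⟨h m, hh m⟩, w m) : Submodule.span K S × (E → K))) := by
    rw [linearIndependent_iff]
    intro c hc
    rw [Finsupp.linearCombination_apply, Finsupp.sum] at hc
    refine H c ?_ fun e => ?_
    · simpa [Prod.fst_sum] using congrArg (fun x => (x.1 : V)) hc
    · simpa [Prod.snd_sum] using congrArg (fun x => x.2 e) hc
  exact hv.finite_of_isNoetherian

theorem eq_of_le_of_degree_le {a b : ℕ →₀ ℕ} (h : a ≤ b) (hd : b.degree ≤ a.degree) : a = b := by
  have h1 := congrArg Finsupp.degree (tsub_add_cancel_of_le h)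
  rw [map_add] at h1
  have h2 : (b - a).degree = 0 := by omega
  rw [Finsupp.degree_eq_zero_iff] at h2
  rw [← tsub_add_cancel_of_le h, h2, zero_add]

section

variable {lt : (ℕ →₀ ℕ) → (ℕ →₀ ℕ) → Prop}

/-- The minimal elements, with respect to divisibility, of the set of initial monomials. -/
def minimalInitial (lt : (ℕ →₀ ℕ) → (ℕ →₀ ℕ) → Prop) (I : Ideal (RP K)) : Set (ℕ →₀ ℕ) :=
  {m | m ∈ initialMonomials lt I ∧ ∀ m' ∈ initialMonomials lt I, m' ≤ m → m' = m}

theorem exists_minimalInitial_le {I : Ideal (RP K)} {m : ℕ →₀ ℕ}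
    (hm : m ∈ initialMonomials lt I) : ∃ t ∈ minimalInitial lt I, t ≤ m := by
  have hne : {t | t ∈ initialMonomials lt I ∧ t ≤ m}.Nonempty := ⟨m, hm, le_rfl⟩
  obtain ⟨t, ⟨ht, hle⟩, hmin⟩ := (measure fun t : ℕ →₀ ℕ => t.degree).wf.has_min _ hne
  refine ⟨t, ⟨ht, fun m' hm' hle' => eq_of_le_of_degree_le hle' ?_⟩, hle⟩
  exact not_lt.1 (hmin m' ⟨hm', hle'.trans hle⟩)

/-- In degree `d`, the ideal is spanned by the finitely many generators of degree `d` and the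
multiples of elements whose initial monomials generate those of smaller degree. -/
theorem exists_homPart_eq (hlt : IsTermOrder lt) {I : Ideal (RP K)} {F : ℕ → Set (RP K)}
    (hF : ∀ k, 1 ≤ k → ∀ f ∈ F k, IsHomogeneousOfDegree f k)
    (hIF : I = Ideal.span (⋃ k ∈ Set.Ici 1, F k)) {d : ℕ}
    (T : Finset (ℕ →₀ ℕ)) (g : (ℕ →₀ ℕ) → RP K) (hgI : ∀ t ∈ T, g t ∈ I)
    (hg : ∀ t ∈ T, HasLead lt (g t) t)
    (hT : ∀ m ∈ initialMonomials lt I, m.degree < d → ∃ t ∈ T, t ≤ m)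
    {f : RP K} (hf : f ∈ I) :
    ∃ h ∈ Submodule.span K (F d), ∃ q : T → RP K,
      (∀ t u, cf u (q t) ≠ 0 → (u + (t : ℕ →₀ ℕ)).degree = d) ∧
      homPart d f = h + ∑ t, q t * g t := by
  -- The induction on the span needs the claim for all multiples.
  suffices H : ∀ c : RP K, ∃ h ∈ Submodule.span K (F d), ∃ q : T → RP K,
      (∀ t u, cf u (q t) ≠ 0 → (u + (t : ℕ →₀ ℕ)).degree = d) ∧
      homPart d (c * f) = h + ∑ t, q t * g t by
    simpa only [one_mul] using H 1
  have hzero : ∃ h ∈ Submodule.span K (F d), ∃ q : T → RP K,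
      (∀ t u, cf u (q t) ≠ 0 → (u + (t : ℕ →₀ ℕ)).degree = d) ∧
      (0 : RP K) = h + ∑ t, q t * g t :=
    ⟨0, Submodule.zero_mem _, fun _ => 0, fun t u h => absurd (map_zero _) h, by simp⟩
  have hf' : f ∈ Ideal.span (⋃ k ∈ Set.Ici 1, F k) := hIF ▸ hf
  induction hf' using Submodule.span_induction with
  | mem x hx =>
    intro c
    have hxI : x ∈ I := hIF ▸ Ideal.subset_span hx
    obtain ⟨k, hk, hxk⟩ := Set.mem_iUnion₂.1 hx
    have hx' : ∀ m, cf m x ≠ 0 → m.degree = k := hF k hk x hxk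
    rcases lt_trichotomy k d with hkd | rfl | hkd
    · obtain ⟨A, hA, hA', -⟩ := exists_representation hlt T g hgI hg (e := k)
        (fun m hm hme => hT m hm (by rwa [hme])) hxI hx'
      refine ⟨0, Submodule.zero_mem _, fun t => homPart (d - k) c * A t, fun t u hu => ?_, ?_⟩
      · obtain ⟨v, w, rfl, hv, hw⟩ := exists_of_cf_mul_ne_zero hu
        have h1 := degree_eq_of_cf_homPart_ne_zero hv
        obtain ⟨u, hu, h⟩ := hA' t w hw
        have h2 : (w + (t : ℕ →₀ ℕ)).degree = k := by
          rcases h with h | h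
          · rw [← h]
            exact hx' u hu
          · rw [← h.1]
            exact hx' u hu
        rw [add_assoc, map_add, h1, h2]
        omega
      · have h := homPart_mul_of_homogeneous (d := d - k) c hx'
        rw [Nat.sub_add_cancel hkd.le] at h
        rw [h, zero_add]
        conv_lhs => rw [hA]
        rw [Finset.mul_sum]
        exact Finset.sum_congr rfl fun t _ => (mul_assoc _ _ _).symm
    · refine ⟨cf 0 c • x, Submodule.smul_mem _ _ (Submodule.subset_span hxk), fun _ => 0,
        fun t u h => absurd (map_zero _) h, ?_⟩
      have h := homPart_mul_of_homogeneous (d := 0) c hx'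
      rw [zero_add] at h
      rw [h, homPart_zero_mul]
      simp
    · rw [homPart_mul_eq_zero hkd c hx']
      exact hzero
  | zero =>
    intro c
    rw [mul_zero, homPart_zero]
    exact hzero
  | add x x' hx hx' ih ih' =>
    intro c
    obtain ⟨h, hh, q, hq, he⟩ := ih (hIF ▸ hx) c
    obtain ⟨h', hh', q', hq', he'⟩ := ih' (hIF ▸ hx') c
    refine ⟨h + h', Submodule.add_mem _ hh hh', fun t => q t + q' t, fun t u hu => ?_, ?_⟩
    · by_cases h0 : cf u (q t) = 0
      · rw [map_add, h0, zero_add] at hu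
        exact hq' t u hu
      · exact hq t u h0
    · rw [mul_add, homPart_add, he, he']
      simp only [add_mul, Finset.sum_add_distrib]
      abel
  | smul a x hx ih =>
    intro c
    rw [smul_eq_mul, ← mul_assoc]
    exact ih (hIF ▸ hx) (c * a)

/-- A nontrivial linear combination of elements with distinct initial monomials of the same degree
has one of these as its initial monomial. -/
theorem exists_isInitialMonomial_linearCombination (hlt : IsTermOrder lt) {G : Set (ℕ →₀ ℕ)}
    {d : ℕ} (hG : ∀ m ∈ G, m.degree = d) (f : G → RP K) (hf : ∀ m : G, HasLead lt (f m) m)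
    (c : G →₀ K) (hc : c ≠ 0) :
    ∃ m : G, IsInitialMonomial lt (c.sum fun m a => a • f m) m := by
  have hne : (Subtype.val '' {m : G | c m ≠ 0}).Nonempty := by
    obtain ⟨m, hm⟩ := Finsupp.ne_iff.1 hc
    exact ⟨m, m, hm, rfl⟩
  obtain ⟨-, ⟨m, hm, rfl⟩, hmin⟩ := hlt.wellFounded_before.has_min _ hne
  have hcf : ∀ w, cf w (c.sum fun m a => a • f m) = ∑ n ∈ c.support, c n * cf w (f n) := by
    intro w
    rw [Finsupp.sum, map_sum]
    simp only [map_smul, smul_eq_mul]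
  have hmax : ∀ n : G, c n ≠ 0 → n = m ∨ lt n m := by
    intro n hn
    rcases hlt.trichotomy n m with h | h | h
    · exact Or.inr h
    · exact Or.inl (Subtype.ext h)
    · exact absurd ⟨by rw [hG _ n.2, hG _ m.2], h⟩ (hmin n ⟨n, hn, rfl⟩)
  refine ⟨m, ?_, fun w hw hne => ?_⟩
  · rw [mem_supp, hcf, Finset.sum_eq_single m]
    · rw [(hf m).1, mul_one]
      exact hm
    · intro n hn hnm
      by_contra h
      have h1 := (hmax n (Finsupp.mem_support_iff.1 hn)).resolve_left hnm
      have h2 := (hf n).2 m (right_ne_zero_of_mul h) fun h => hnm (Subtype.ext h.symm)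
      exact hlt.irrefl _ (hlt.trans h1 h2.2)
    · exact fun h => absurd (Finsupp.mem_support_iff.2 hm) h
  · rw [mem_supp, hcf] at hw
    obtain ⟨n, hn, hne'⟩ := Finset.exists_ne_zero_of_sum_ne_zero hw
    have h1 := hmax n (Finsupp.mem_support_iff.1 hn)
    by_cases hwn : w = n
    · subst hwn
      exact h1.resolve_left fun h => hne (by rw [h])
    · have h2 := ((hf n).2 w (right_ne_zero_of_mul hne') hwn).2
      rcases h1 with h1 | h1
      · rwa [← h1]
      · exact hlt.trans h2 h1

/-- The inductive step of Buchberger's criterion: if there are finitely many minimal initial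
monomials of degree less than `d`, then there are finitely many of degree `d`. A homogeneous
element of degree `d` of the ideal is a combination of the generators of degree `d` and of
multiples of elements of smaller degree, reduced in the sense of `exists_reduced_combination`. The
former coefficients, and the coefficients of the latter at the finitely many positions that come
from least common multiples of degree `d`, are finitely many linear conditions. If they vanish,
the initial monomial is a multiple of one of smaller degree. -/
theorem finite_minimalInitial_step {r : ℕ} (y : ℕ → Fin r) (hlt : IsTermOrder lt)
    {I : Ideal (RP K)} (hI : IsRHomogeneous y I) {F : ℕ → Set (RP K)}
    (hF : ∀ k, 1 ≤ k → (F k).Finite ∧ ∀ f ∈ F k, IsHomogeneousOfDegree f k)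
    (hIF : I = Ideal.span (⋃ k ∈ Set.Ici 1, F k)) {d : ℕ} (hd : 1 ≤ d)
    (hfin : {m | m ∈ minimalInitial lt I ∧ m.degree < d}.Finite) :
    {m | m ∈ minimalInitial lt I ∧ m.degree = d}.Finite := by
  classical
  set T : Finset (ℕ →₀ ℕ) := hfin.toFinset with hTdef
  have hTmem : ∀ {t}, t ∈ T ↔ t ∈ minimalInitial lt I ∧ t.degree < d := by
    intro t
    rw [hTdef, Set.Finite.mem_toFinset]
    rfl
  obtain ⟨g, hg⟩ := exists_hasLead_family (lt := lt) y hI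
  have hgI : ∀ t ∈ T, g t ∈ I := fun t ht => (hg t (hTmem.1 ht).1.1).1
  have hgL : ∀ t ∈ T, HasLead lt (g t) t := fun t ht => (hg t (hTmem.1 ht).1.1).2
  have hT : ∀ m ∈ initialMonomials lt I, m.degree < d → ∃ t ∈ T, t ≤ m := by
    intro m hm hmd
    obtain ⟨t, ht, hle⟩ := exists_minimalInitial_le hm
    exact ⟨t, hTmem.2 ⟨ht, (Finsupp.degree_mono hle).trans_lt hmd⟩, hle⟩
  set G : Set (ℕ →₀ ℕ) := {m | m ∈ minimalInitial lt I ∧ m.degree = d} with hGdef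
  have hG : ∀ m ∈ G, m.degree = d := fun m hm => hm.2
  have hrep : ∀ m : G, ∃ h ∈ Submodule.span K (F d), ∃ q : T → RP K,
      g m = h + ∑ t, q t * g t ∧
      (∀ t u, cf u (q t) ≠ 0 → (u + (t : ℕ →₀ ℕ)).degree = d) ∧
      ∀ t u, cf u (q t) ≠ 0 → ∀ t' : T, lt t' t → (t' : ℕ →₀ ℕ) ≤ u + t →
        d ≤ ((t : ℕ →₀ ℕ) ⊔ t').degree := by
    intro m
    obtain ⟨h, hh, q, hq, he⟩ := exists_homPart_eq hlt (fun k hk => (hF k hk).2) hIF T g hgI hgL hT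
      (hg m m.2.1.1).1
    rw [homPart_of_homogeneous] at he
    · obtain ⟨q', h1, h2, h3⟩ := exists_reduced_combination hlt T g hgI hgL hT q hq
      exact ⟨h, hh, q', by rw [h1, he], h2, h3⟩
    · intro w hw
      rw [(hg m m.2.1.1).2.degree_eq hw, hG m m.2]
  choose h hh q hq hqd hqr using hrep
  refine Set.finite_coe_iff.1 (finite_of_forall_eq_zero (hF d hd).1 h hh
    (fun m (p : T × T) => cf ((p.1 : ℕ →₀ ℕ) ⊔ p.2 - p.1) (q m p.1)) fun c hc1 hc2 => ?_)
  by_contra hne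
  obtain ⟨m, hm⟩ := exists_isInitialMonomial_linearCombination hlt hG (fun m => g m)
    (fun m => (hg m m.2.1.1).2) c hne
  let Q : T → RP K := fun t => ∑ m ∈ c.support, c m • q m t
  have hQcf : ∀ t u, cf u (Q t) = ∑ m ∈ c.support, c m * cf u (q m t) := by
    intro t u
    simp only [Q, map_sum, map_smul, smul_eq_mul]
  have hQex : ∀ t u, cf u (Q t) ≠ 0 → ∃ m, cf u (q m t) ≠ 0 := by
    intro t u hu
    rw [hQcf] at hu
    obtain ⟨m, -, hm⟩ := Finset.exists_ne_zero_of_sum_ne_zero hu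
    exact ⟨m, right_ne_zero_of_mul hm⟩
  have hQ : (c.sum fun m a => a • g m) = ∑ t, Q t * g t := by
    rw [Finsupp.sum]
    have h1 : ∀ m : G, c m • g m = c m • h m + ∑ t, (c m • q m t) * g t := by
      intro m
      conv_lhs => rw [hq m]
      rw [smul_add, Finset.smul_sum]
      simp only [smul_mul_assoc]
    simp only [h1, Finset.sum_add_distrib, hc1, zero_add, Q, Finset.sum_mul]
    rw [Finset.sum_comm]
  have hQd : ∀ t u, cf u (Q t) ≠ 0 → (u + (t : ℕ →₀ ℕ)).degree = d := by
    intro t u hu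
    obtain ⟨m, hm⟩ := hQex t u hu
    exact hqd m t u hm
  -- For reasons of degree, a position excluded here would come from one of the least common
  -- multiples, where `Q` vanishes by the choice of the linear conditions.
  have hQr : ∀ t u, cf u (Q t) ≠ 0 → ∀ t' : T, lt t' t → ¬ (t' : ℕ →₀ ℕ) ≤ u + t := by
    intro t u hu t' ht' hle
    obtain ⟨m, hm⟩ := hQex t u hu
    have h1 := hqr m t u hm t' ht' hle
    have h2 : (t : ℕ →₀ ℕ) ⊔ t' = u + t :=
      eq_of_le_of_degree_le (sup_le le_add_self hle) (by rw [hqd m t u hm]; exact h1)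
    have h3 := hc2 (t, t')
    simp only [h2, add_tsub_cancel_right] at h3
    rw [← hQcf] at h3
    exact hu h3
  rw [hQ] at hm
  obtain ⟨t, u, hu, -, h1, h2⟩ := exists_initial_of_sum hlt (fun t : T => (t : ℕ →₀ ℕ))
    (fun t => g t) Q (fun t => hgL t t.2) hQd
    (fun t t' u u' hu hu' he => by
      rcases hlt.trichotomy t t' with h | h | h
      · exact absurd (he ▸ le_add_self) (hQr t' u' hu' t h)
      · exact Subtype.ext h
      · exact absurd (he ▸ le_add_self) (hQr t u hu t' h))
    Set.univ (fun _ _ _ => Set.mem_univ _) (fun _ _ _ => Set.mem_univ _)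
    (Set.mem_univ (m : ℕ →₀ ℕ)) hm.1
  have h3 : (m : ℕ →₀ ℕ) = u + t :=
    hm.eq hlt ⟨h1, fun w hw hne => h2 w (Set.mem_univ _) hw hne⟩
  have h4 := m.2.1.2 t (hTmem.1 t.2).1.1 (by rw [h3]; exact le_add_self)
  have h5 := (hTmem.1 t.2).2
  rw [h4, hG m m.2] at h5
  exact lt_irrefl _ h5

theorem finite_minimalInitial {r : ℕ} (y : ℕ → Fin r) (hlt : IsTermOrder lt)
    {I : Ideal (RP K)} (hI : IsRHomogeneous y I) (hlfg : IsLFG I) (d : ℕ) :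
    {m | m ∈ minimalInitial lt I ∧ m.degree = d}.Finite := by
  obtain ⟨F, hF, hIF⟩ := hlfg
  induction d using Nat.strong_induction_on with
  | _ d ih =>
    rcases Nat.eq_zero_or_pos d with rfl | hd
    · refine (Set.finite_singleton 0).subset fun m hm => ?_
      exact (Finsupp.degree_eq_zero_iff m).1 hm.2
    · refine finite_minimalInitial_step y hlt hI hF hIF hd ?_
      refine ((Set.finite_Iio d).biUnion fun e he => ih e he).subset fun m hm => ?_
      exact Set.mem_biUnion (Set.mem_Iio.2 hm.2) ⟨hm.1, rfl⟩

theorem finite_minimalInitial_le {r : ℕ} (y : ℕ → Fin r) (hlt : IsTermOrder lt)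
    {I : Ideal (RP K)} (hI : IsRHomogeneous y I) (hlfg : IsLFG I) (d : ℕ) :
    {m | m ∈ minimalInitial lt I ∧ m.degree ≤ d}.Finite := by
  refine ((Set.finite_Iic d).biUnion fun e _ => finite_minimalInitial y hlt hI hlfg e).subset
    fun m hm => ?_
  exact Set.mem_biUnion (Set.mem_Iic.2 hm.2) ⟨hm.1, rfl⟩

end

/-! ### Monomial ideals -/

theorem exists_le_of_mem_span_mon {S : Set (ℕ →₀ ℕ)} {f : RP K} (hf : f ∈ Ideal.span (mon K '' S))
    {m : ℕ →₀ ℕ} (hm : cf m f ≠ 0) : ∃ s ∈ S, s ≤ m := by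
  induction hf using Submodule.span_induction generalizing m with
  | mem x hx =>
    obtain ⟨s, hs, rfl⟩ := hx
    rw [cf_mon] at hm
    refine ⟨s, hs, ?_⟩
    by_contra h
    rw [if_neg fun h' => h h'.ge] at hm
    exact hm rfl
  | zero => exact absurd (map_zero _) hm
  | add x x' _ _ ih ih' =>
    by_cases h : cf m x = 0
    · rw [map_add, h, zero_add] at hm
      exact ih' hm
    · exact ih h
  | smul a x _ ih =>
    obtain ⟨u, v, rfl, -, hv⟩ := exists_of_cf_mul_ne_zero hm
    obtain ⟨s, hs, hle⟩ := ih hv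
    exact ⟨s, hs, hle.trans le_add_self⟩

theorem mon_mem_of_le {J : Ideal (RP K)} {s m : ℕ →₀ ℕ} (hs : mon K s ∈ J) (h : s ≤ m) :
    mon K m ∈ J := by
  rw [← tsub_add_cancel_of_le h, mon_add]
  exact J.mul_mem_left _ hs

theorem isInitialMonomial_mon (lt : (ℕ →₀ ℕ) → (ℕ →₀ ℕ) → Prop) (m : ℕ →₀ ℕ) :
    IsInitialMonomial lt (mon K m) m := by
  refine ⟨?_, fun m' hm' hne => ?_⟩
  · rw [mem_supp, cf_mon, if_pos rfl]
    exact one_ne_zero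
  · rw [mem_supp, cf_mon, if_neg hne] at hm'
    exact absurd rfl hm'

theorem exists_eq_mon_mul {f : RP K} {s : ℕ →₀ ℕ} (h : ∀ m, cf m f ≠ 0 → s ≤ m) :
    ∃ c, f = mon K s * c := by
  obtain ⟨d, hd⟩ := f.2
  refine ⟨ofCoeff (fun m => cf (s + m) f) ⟨d, fun m hm => ?_⟩, ext_cf fun m => ?_⟩
  · have := hd _ hm
    rw [map_add] at this
    omega
  · by_cases hm : s ≤ m
    · obtain ⟨v, rfl⟩ := exists_add_of_le hm
      rw [cf_mon_mul, cf_ofCoeff]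
    · rw [not_not.1 (mt (h m) hm)]
      by_contra hne
      obtain ⟨v, rfl, -⟩ := exists_of_cf_mon_mul_ne_zero (Ne.symm hne)
      exact hm le_self_add

theorem component_add {r : ℕ} (y : ℕ → Fin r) (α : Fin r →₀ ℕ) (f g : RP K) :
    component y α (f + g) = component y α f + component y α g := by
  refine ext_cf fun m => ?_
  simp only [map_add, cf_component]
  split_ifs <;> simp

theorem IsMonomialIdeal.isRHomogeneous {r : ℕ} (y : ℕ → Fin r) {J : Ideal (RP K)}
    (hJ : IsMonomialIdeal J) : IsRHomogeneous y J := by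
  obtain ⟨S, rfl⟩ := hJ
  intro f hf α
  -- The induction on the span needs the claim for all multiples.
  suffices H : ∀ c : RP K, component y α (c * f) ∈ Ideal.span (mon K '' S) by
    simpa only [one_mul] using H 1
  induction hf using Submodule.span_induction with
  | mem x hx =>
    intro c
    obtain ⟨s, hs, rfl⟩ := hx
    have h : ∀ m, cf m (component y α (c * mon K s)) ≠ 0 → s ≤ m := by
      intro m hm
      rw [cf_component] at hm
      split_ifs at hm with h
      · rw [mul_comm] at hm
        obtain ⟨v, rfl, -⟩ := exists_of_cf_mon_mul_ne_zero hm
        exact le_self_add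
      · exact absurd rfl hm
    obtain ⟨c', hc'⟩ := exists_eq_mon_mul h
    rw [hc']
    exact Ideal.mul_mem_right _ _ (Ideal.subset_span ⟨s, hs, rfl⟩)
  | zero =>
    intro c
    rw [mul_zero]
    have : component y α (0 : RP K) = 0 := ext_cf fun m => by
      rw [cf_component, map_zero, ite_self]
    rw [this]
    exact Ideal.zero_mem _
  | add x x' _ _ ih ih' =>
    intro c
    rw [mul_add, component_add]
    exact Ideal.add_mem _ (ih c) (ih' c)
  | smul a x _ ih =>
    intro c
    rw [smul_eq_mul, ← mul_assoc]
    exact ih (c * a)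

section

variable {lt : (ℕ →₀ ℕ) → (ℕ →₀ ℕ) → Prop}

theorem mem_initialMonomials_of_le (hlt : IsTermOrder lt) {I : Ideal (RP K)} {s m : ℕ →₀ ℕ}
    (hs : s ∈ initialMonomials lt I) (h : s ≤ m) : m ∈ initialMonomials lt I := by
  rw [← tsub_add_cancel_of_le h]
  exact add_mem_initialMonomials hlt hs _

theorem mon_mem_initialIdeal (hlt : IsTermOrder lt) {I : Ideal (RP K)} {m : ℕ →₀ ℕ} :
    mon K m ∈ initialIdeal lt I ↔ m ∈ initialMonomials lt I := by
  constructor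
  · intro h
    obtain ⟨s, hs, hle⟩ := exists_le_of_mem_span_mon h (isInitialMonomial_mon lt m).1
    exact mem_initialMonomials_of_le hlt hs hle
  · exact fun h => Ideal.subset_span ⟨m, h, rfl⟩

theorem IsMonomialIdeal.mem_initialMonomials {J : Ideal (RP K)} (hJ : IsMonomialIdeal J)
    {m : ℕ →₀ ℕ} : m ∈ initialMonomials lt J ↔ mon K m ∈ J := by
  constructor
  · rintro ⟨f, hf, hm, -⟩
    obtain ⟨S, rfl⟩ := hJ
    obtain ⟨s, hs, hle⟩ := exists_le_of_mem_span_mon hf hm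
    exact mon_mem_of_le (Ideal.subset_span ⟨s, hs, rfl⟩) hle
  · exact fun h => ⟨_, h, isInitialMonomial_mon lt m⟩

theorem isMonomialIdeal_initialIdeal (I : Ideal (RP K)) :
    IsMonomialIdeal (initialIdeal lt I) := ⟨_, rfl⟩

theorem IsMonomialIdeal.initialIdeal_eq {J : Ideal (RP K)} (hJ : IsMonomialIdeal J) :
    initialIdeal lt J = J := by
  apply le_antisymm
  · refine Ideal.span_le.2 ?_
    rintro - ⟨m, hm, rfl⟩
    exact hJ.mem_initialMonomials.1 hm
  · obtain ⟨S, hS⟩ := id hJ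
    nth_rw 1 [hS]
    refine Ideal.span_le.2 ?_
    rintro - ⟨s, hs, rfl⟩
    refine Ideal.subset_span ⟨s, hJ.mem_initialMonomials.2 ?_, rfl⟩
    rw [hS]
    exact Ideal.subset_span ⟨s, hs, rfl⟩

theorem IsLFG.cf_zero {I : Ideal (RP K)} (hI : IsLFG I) {f : RP K} (hf : f ∈ I) : cf 0 f = 0 := by
  obtain ⟨F, hF, rfl⟩ := hI
  induction hf using Submodule.span_induction with
  | mem x hx =>
    obtain ⟨k, hk, hxk⟩ := Set.mem_iUnion₂.1 hx
    by_contra h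
    have h1 := (hF k hk).2 x hxk 0 h
    rw [map_zero] at h1
    subst h1
    exact absurd (Set.mem_Ici.1 hk) (by omega)
  | zero => exact map_zero _
  | add x x' _ _ ih ih' => rw [map_add, ih, ih', add_zero]
  | smul a x _ ih =>
    by_contra h
    obtain ⟨u, v, huv, -, hv⟩ := exists_of_cf_mul_ne_zero h
    rw [(add_eq_zero.1 huv).2] at hv
    exact hv ih

theorem isLFG_initialIdeal {r : ℕ} (y : ℕ → Fin r) (hlt : IsTermOrder lt)
    {I : Ideal (RP K)} (hI : IsRHomogeneous y I) (hlfg : IsLFG I) :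
    IsLFG (initialIdeal lt I) := by
  refine ⟨fun d => mon K '' {m | m ∈ minimalInitial lt I ∧ m.degree = d}, fun d _ => ⟨?_, ?_⟩, ?_⟩
  · exact (finite_minimalInitial y hlt hI hlfg d).image _
  · rintro - ⟨m, hm, rfl⟩ m' hm'
    rw [mem_supp, cf_mon] at hm'
    by_cases h : m' = m
    · rw [h, hm.2]
    · rw [if_neg h] at hm'
      exact absurd rfl hm'
  · apply le_antisymm
    · refine Ideal.span_le.2 ?_
      rintro - ⟨m, hm, rfl⟩
      obtain ⟨t, ht, hle⟩ := exists_minimalInitial_le hm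
      refine mon_mem_of_le (Ideal.subset_span (Set.mem_iUnion₂.2
        ⟨t.degree, Set.mem_Ici.2 (Nat.one_le_iff_ne_zero.2 fun h => ?_), t, ⟨ht, rfl⟩, rfl⟩)) hle
      obtain ⟨f, hf, hft, -⟩ := ht.1
      rw [Finsupp.degree_eq_zero_iff] at h
      rw [h] at hft
      exact hft (hlfg.cf_zero hf)
    · refine Ideal.span_le.2 fun x hx => ?_
      obtain ⟨k, -, m, hm, rfl⟩ := Set.mem_iUnion₂.1 hx
      exact (mon_mem_initialIdeal hlt).2 hm.1.1

end

/-- The lexicographic order is a term order. -/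
theorem exists_isTermOrder : ∃ lt : (ℕ →₀ ℕ) → (ℕ →₀ ℕ) → Prop, IsTermOrder lt := by
  refine ⟨fun a b => toLex a < toLex b, ?_, fun a b c h => ?_, ⟨RelIso.refl _ |>.trans ?_⟩⟩
  · exact inferInstanceAs (IsStrictTotalOrder (Lex (ℕ →₀ ℕ)) (· < ·))
  · exact add_lt_add_left h (toLex c)
  · exact ⟨Equiv.refl ℕ, fun {i j} => (Finsupp.Lex.single_strictAnti.lt_iff_gt).symm⟩

/-! ### Hilbert functions of truncations -/

/-- A monomial in the first `n` variables, considered as a monomial in all variables. -/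
def emb {n : ℕ} (m : Fin n →₀ ℕ) : ℕ →₀ ℕ := m.embDomain Fin.valEmbedding

theorem emb_injective (n : ℕ) : Function.Injective (emb (n := n)) :=
  Finsupp.embDomain_injective _

theorem mem_range_emb {n : ℕ} {w : ℕ →₀ ℕ} :
    w ∈ Set.range (emb (n := n)) ↔ ∀ i, n ≤ i → w i = 0 := by
  change w ∈ Set.range (Finsupp.embDomain Fin.valEmbedding) ↔ _
  rw [Finsupp.mem_range_embDomain_iff]
  constructor
  · intro h i hi
    by_contra hne
    obtain ⟨j, hj⟩ := h (Finsupp.mem_support_iff.2 hne)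
    have := j.2
    change (j : ℕ) = i at hj
    omega
  · intro h i hi
    have hlt : i < n := by
      by_contra hn
      exact Finsupp.mem_support_iff.1 hi (h i (not_lt.1 hn))
    exact ⟨⟨i, hlt⟩, rfl⟩

theorem degree_emb {n : ℕ} (m : Fin n →₀ ℕ) : (emb m).degree = m.degree := by
  rw [emb, Finsupp.embDomain_eq_mapDomain, Finsupp.degree_mapDomain]

theorem multideg_emb {r n : ℕ} (y : ℕ → Fin r) (m : Fin n →₀ ℕ) :
    multideg y (emb m) = Finsupp.weight (fun i : Fin n => Finsupp.single (y i) 1) m := by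
  rw [multideg, emb, Finsupp.weight_apply, Finsupp.weight_apply, Finsupp.sum_embDomain]
  rfl

theorem coeff_restr_eq_cf {n : ℕ} (f : RP K) (m : Fin n →₀ ℕ) :
    MvPolynomial.coeff m (restr n f) = cf (emb m) f := coeff_restr n f m

theorem restr_surjective (n : ℕ) : Function.Surjective (restr (K := K) n) := by
  classical
  have h : ((restr (K := K) n).comp
      (MvPolynomial.aeval fun i : Fin n => mon K (Finsupp.single (i : ℕ) 1))) = AlgHom.id K _ := by
    refine MvPolynomial.algHom_ext fun i => ?_
    rw [AlgHom.comp_apply, MvPolynomial.aeval_X, AlgHom.id_apply]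
    ext m
    have h1 : emb (Finsupp.single i 1) = Finsupp.single (i : ℕ) 1 := Finsupp.embDomain_single _ _ _
    rw [coeff_restr_eq_cf, cf_mon, MvPolynomial.coeff_X, ← h1]
    simp only [(emb_injective n).eq_iff, eq_comm]
  exact fun p => ⟨_, DFunLike.congr_fun h p⟩

section

variable {lt : (ℕ →₀ ℕ) → (ℕ →₀ ℕ) → Prop}

/-- The minimal initial monomials of degree at most `d` involve finitely many variables. -/
theorem exists_variable_bound {r : ℕ} (y : ℕ → Fin r) (hlt : IsTermOrder lt)
    {I : Ideal (RP K)} (hI : IsRHomogeneous y I) (hlfg : IsLFG I) (d : ℕ) :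
    ∃ N, ∀ t ∈ minimalInitial lt I, t.degree ≤ d → ∀ i, N ≤ i → t i = 0 := by
  have hfin := finite_minimalInitial_le y hlt hI hlfg d
  refine ⟨hfin.toFinset.sup fun t => t.support.sup fun i => i + 1, fun t ht htd i hi => ?_⟩
  by_contra h
  have h1 : t.support.sup (fun i => i + 1) ≤
      hfin.toFinset.sup fun t => t.support.sup fun i => i + 1 :=
    Finset.le_sup (f := fun t : ℕ →₀ ℕ => t.support.sup fun i => i + 1)
      (hfin.mem_toFinset.2 ⟨ht, htd⟩)
  have h2 : i + 1 ≤ t.support.sup (fun i => i + 1) :=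
    Finset.le_sup (f := fun i => i + 1) (Finsupp.mem_support_iff.2 h)
  omega

/-- If the truncation of a homogeneous element `f` of the ideal to the first `n` variables does not
vanish, then it contains an initial monomial of the ideal, provided that `n` is large with respect
to the degree. In fact the largest monomial of the truncation is one: truncation of a standard
representation of `f` keeps the initial monomials of the divisors, and thus keeps the leading terms
of the summands distinct. -/
theorem exists_initialMonomial_of_truncation {r : ℕ} (y : ℕ → Fin r) (hlt : IsTermOrder lt)
    {I : Ideal (RP K)} (hI : IsRHomogeneous y I) (hlfg : IsLFG I) {e n : ℕ}
    (hn : ∀ t ∈ minimalInitial lt I, t.degree ≤ e → ∀ i, n ≤ i → t i = 0)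
    {f : RP K} (hf : f ∈ I) (hfe : ∀ m, cf m f ≠ 0 → m.degree = e)
    {w : ℕ →₀ ℕ} (hw : ∀ i, n ≤ i → w i = 0) (hwf : cf w f ≠ 0) :
    ∃ m ∈ initialMonomials lt I, (∀ i, n ≤ i → m i = 0) ∧ cf m f ≠ 0 := by
  have hfin := finite_minimalInitial_le y hlt hI hlfg e
  obtain ⟨g, hg⟩ := exists_hasLead_family (lt := lt) y hI
  have hT : ∀ t : hfin.toFinset, (t : ℕ →₀ ℕ) ∈ minimalInitial lt I ∧ (t : ℕ →₀ ℕ).degree ≤ e :=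
    fun t => hfin.mem_toFinset.1 t.2
  obtain ⟨A, hA, hA1, hA2⟩ := exists_representation hlt hfin.toFinset g
    (fun t ht => (hg t (hT ⟨t, ht⟩).1.1).1) (fun t ht => (hg t (hT ⟨t, ht⟩).1.1).2)
    (e := e) (fun m hm hme => by
      obtain ⟨t, ht, hle⟩ := exists_minimalInitial_le hm
      exact ⟨t, hfin.mem_toFinset.2 ⟨ht, (Finsupp.degree_mono hle).trans hme.le⟩, hle⟩) hf hfe
  obtain ⟨t, u, -, h1, h2, -⟩ := exists_initial_of_sum hlt
    (fun t : hfin.toFinset => (t : ℕ →₀ ℕ)) (fun t => g t) A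
    (fun t => (hg t (hT t).1.1).2) (d := e)
    (fun t v hv => by
      obtain ⟨u, hu, h⟩ := hA1 t v hv
      rcases h with h | h
      · rw [← h]
        exact hfe u hu
      · rw [← h.1]
        exact hfe u hu)
    (fun t t' u v hu hv h => hA2 t t' u v hu hv h)
    {m | ∀ i, n ≤ i → m i = 0}
    (fun u v h i hi => by
      have := h i hi
      rw [Finsupp.add_apply] at this
      omega)
    (fun t u h i hi => by
      rw [Finsupp.add_apply, h i hi, hn t (hT t).1 (hT t).2 i hi])
    hw (by rwa [← hA])
  rw [← hA] at h2
  exact ⟨_, add_mem_initialMonomials hlt (hT t).1.1 u, h1, h2⟩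

/-- The monomials of multi-degree `α` in the first `n` variables that are not initial monomials. -/
def StandardMonomial {r : ℕ} (y : ℕ → Fin r) (lt : (ℕ →₀ ℕ) → (ℕ →₀ ℕ) → Prop)
    (I : Ideal (RP K)) (n : ℕ) (α : Fin r →₀ ℕ) : Type :=
  {m : Fin n →₀ ℕ // multideg y (emb m) = α ∧ emb m ∉ initialMonomials lt I}

theorem finite_multideg_emb {r : ℕ} (y : ℕ → Fin r) (n : ℕ) (α : Fin r →₀ ℕ) :
    {m : Fin n →₀ ℕ | multideg y (emb m) = α}.Finite := by
  refine (Finsupp.finite_of_degree_le α.degree).subset fun m hm => ?_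
  have hm' : multideg y (emb m) = α := hm
  change m.degree ≤ α.degree
  rw [← degree_emb, ← degree_multideg y, hm']

theorem finite_standardMonomial {r : ℕ} (y : ℕ → Fin r) (lt : (ℕ →₀ ℕ) → (ℕ →₀ ℕ) → Prop)
    (I : Ideal (RP K)) (n : ℕ) (α : Fin r →₀ ℕ) : Finite (StandardMonomial y lt I n α) :=
  ((finite_multideg_emb y n α).subset fun _ hm => hm.1).to_subtype

/-- The image of a monomial in the quotient by the truncated ideal. -/
def monomialClass (I : Ideal (RP K)) (n : ℕ) (m : Fin n →₀ ℕ) :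
    MvPolynomial (Fin n) K ⧸ I.map (restr (K := K) n) :=
  Ideal.Quotient.mkₐ K _ (MvPolynomial.monomial m 1)

theorem mkₐ_eq_sum_monomialClass (I : Ideal (RP K)) {n : ℕ} (p : MvPolynomial (Fin n) K) :
    Ideal.Quotient.mkₐ K (I.map (restr (K := K) n)) p =
      ∑ m ∈ p.support, p.coeff m • monomialClass I n m := by
  conv_lhs => rw [p.as_sum, map_sum]
  refine Finset.sum_congr rfl fun m _ => ?_
  rw [monomialClass, ← map_smul, MvPolynomial.smul_monomial, smul_eq_mul, mul_one]

/-- Standard monomials span: a monomial that is an initial monomial is congruent to a combination of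
smaller ones of the same multi-degree, and there are finitely many of these in `n` variables. -/
theorem monomialClass_mem_span {r : ℕ} (y : ℕ → Fin r) (hlt : IsTermOrder lt)
    {I : Ideal (RP K)} (hI : IsRHomogeneous y I) {n : ℕ} {α : Fin r →₀ ℕ} (m : Fin n →₀ ℕ)
    (hm : multideg y (emb m) = α) :
    monomialClass I n m ∈ Submodule.span K
      (Set.range fun s : StandardMonomial y lt I n α => monomialClass I n s.1) := by
  classical
  let P := {m : Fin n →₀ ℕ // multideg y (emb m) = α}
  have : Finite P := (finite_multideg_emb y n α).to_subtype
  have hwf : WellFounded fun s s' : P => lt (emb s.1) (emb s'.1) := by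
    have : IsTrans P fun s s' : P => lt (emb s.1) (emb s'.1) :=
      ⟨fun a b c h h' => hlt.trans h h'⟩
    have : Std.Irrefl fun s s' : P => lt (emb s.1) (emb s'.1) := ⟨fun a => hlt.irrefl _⟩
    exact Finite.wellFounded_of_trans_of_irrefl _
  suffices H : ∀ s : P, monomialClass I n s.1 ∈ Submodule.span K
      (Set.range fun s : StandardMonomial y lt I n α => monomialClass I n s.1) from H ⟨m, hm⟩
  intro s
  induction s using hwf.induction with
  | _ s ih =>
    by_cases hs : emb s.1 ∈ initialMonomials lt I
    · obtain ⟨g, hgI, hg1, hg2⟩ := exists_hasLead y hI hs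
      set f := component y α g
      have hfI : f ∈ I := hI g hgI α
      set p : MvPolynomial (Fin n) K := MvPolynomial.monomial s.1 1 - restr n f with hp
      have h1 : monomialClass I n s.1 = Ideal.Quotient.mkₐ K (I.map (restr (K := K) n)) p := by
        rw [hp, map_sub]
        have : Ideal.Quotient.mkₐ K (I.map (restr (K := K) n)) (restr n f) = 0 :=
          Ideal.Quotient.eq_zero_iff_mem.2 (Ideal.mem_map_of_mem _ hfI)
        rw [this, sub_zero]
        rfl
      rw [h1, mkₐ_eq_sum_monomialClass]
      refine Submodule.sum_mem _ fun m hm => Submodule.smul_mem _ _ ?_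
      rw [MvPolynomial.mem_support_iff, hp, MvPolynomial.coeff_sub, MvPolynomial.coeff_monomial,
        coeff_restr_eq_cf, cf_component] at hm
      have hne : m ≠ s.1 := by
        rintro rfl
        rw [if_pos rfl, if_pos s.2, hg1, sub_self] at hm
        exact hm rfl
      rw [if_neg (Ne.symm hne), zero_sub, neg_ne_zero] at hm
      split_ifs at hm with hα
      · exact ih ⟨m, hα⟩ (hg2 _ hm fun h => hne (emb_injective n h)).2
      · exact absurd rfl hm
    · exact Submodule.subset_span ⟨⟨s.1, s.2, hs⟩, rfl⟩

theorem quotientComponent_eq_span {r : ℕ} (y : ℕ → Fin r) (hlt : IsTermOrder lt)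
    {I : Ideal (RP K)} (hI : IsRHomogeneous y I) (n : ℕ) (α : Fin r →₀ ℕ) :
    quotientComponent y (I.map (restr (K := K) n)) α = Submodule.span K
      (Set.range fun s : StandardMonomial y lt I n α => monomialClass I n s.1) := by
  apply le_antisymm
  · rintro - ⟨p, hp, rfl⟩
    change Ideal.Quotient.mkₐ K (I.map (restr (K := K) n)) p ∈ _
    rw [mkₐ_eq_sum_monomialClass]
    refine Submodule.sum_mem _ fun m hm => Submodule.smul_mem _ _ ?_
    refine monomialClass_mem_span y hlt hI m ?_
    rw [multideg_emb]
    exact hp (MvPolynomial.mem_support_iff.1 hm)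
  · refine Submodule.span_le.2 ?_
    rintro - ⟨s, rfl⟩
    refine ⟨MvPolynomial.monomial s.1 1, ?_, rfl⟩
    refine MvPolynomial.isWeightedHomogeneous_monomial _ _ _ ?_
    rw [← multideg_emb]
    exact s.2.1

/-- A relation between the classes of standard monomials would come from an element of the ideal
whose truncation contains no initial monomial of the ideal. -/
theorem linearIndependent_monomialClass {r : ℕ} (y : ℕ → Fin r) (hlt : IsTermOrder lt)
    {I : Ideal (RP K)} (hI : IsRHomogeneous y I) (hlfg : IsLFG I) {n : ℕ} {α : Fin r →₀ ℕ}
    (hn : ∀ t ∈ minimalInitial lt I, t.degree ≤ α.degree → ∀ i, n ≤ i → t i = 0) :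
    LinearIndependent K fun s : StandardMonomial y lt I n α => monomialClass I n s.1 := by
  classical
  rw [linearIndependent_iff]
  intro c hc
  by_contra hne
  set p : MvPolynomial (Fin n) K := c.sum fun s a => MvPolynomial.monomial s.1 a with hp
  have hcoeff : ∀ m, p.coeff m = ∑ s ∈ c.support, if s.1 = m then c s else 0 := by
    intro m
    rw [hp, Finsupp.sum, MvPolynomial.coeff_sum]
    simp only [MvPolynomial.coeff_monomial]
  have hmk : Ideal.Quotient.mkₐ K (I.map (restr (K := K) n)) p = 0 := by
    rw [← hc, Finsupp.linearCombination_apply, hp, Finsupp.sum, Finsupp.sum, map_sum]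
    refine Finset.sum_congr rfl fun s _ => ?_
    rw [monomialClass, ← map_smul, MvPolynomial.smul_monomial, smul_eq_mul, mul_one]
  obtain ⟨f, hf, hfp⟩ := (Ideal.mem_map_iff_of_surjective _ (restr_surjective n)).1
    (Ideal.Quotient.eq_zero_iff_mem.1 hmk)
  obtain ⟨s, hs⟩ := Finsupp.ne_iff.1 hne
  have hsf : cf (emb s.1) (component y α f) ≠ 0 := by
    rw [cf_component, if_pos s.2.1, ← coeff_restr_eq_cf]
    rw [show restr n f = p from hfp, hcoeff, Finset.sum_eq_single s, if_pos rfl]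
    · exact hs
    · intro s' _ hne
      exact if_neg fun h => hne (Subtype.ext h)
    · exact fun h => absurd (Finsupp.mem_support_iff.2 hs) h
  obtain ⟨m, hm, hmn, hmf⟩ := exists_initialMonomial_of_truncation y hlt hI hlfg hn (hI f hf α)
    (fun m hm => by
      rw [cf_component] at hm
      split_ifs at hm with h
      · rw [← degree_multideg y, h]
      · exact absurd rfl hm)
    (mem_range_emb.1 ⟨s.1, rfl⟩) hsf
  obtain ⟨m, rfl⟩ := mem_range_emb.2 hmn
  rw [cf_component] at hmf
  split_ifs at hmf with hα
  · rw [← coeff_restr_eq_cf, show restr n f = p from hfp, hcoeff] at hmf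
    obtain ⟨s', -, hs'⟩ := Finset.exists_ne_zero_of_sum_ne_zero hmf
    split_ifs at hs' with h
    · exact s'.2.2 (h ▸ hm)
    · exact hs' rfl
  · exact hmf rfl

/-- The Hilbert function of the truncated quotient counts standard monomials. -/
theorem coeff_hilbertSeries {r : ℕ} (y : ℕ → Fin r) (hlt : IsTermOrder lt)
    {I : Ideal (RP K)} (hI : IsRHomogeneous y I) (hlfg : IsLFG I) {n : ℕ} {α : Fin r →₀ ℕ}
    (hn : ∀ t ∈ minimalInitial lt I, t.degree ≤ α.degree → ∀ i, n ≤ i → t i = 0) :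
    MvPowerSeries.coeff α (hilbertSeries y (I.map (restr (K := K) n))) =
      (Nat.card (StandardMonomial y lt I n α) : ℤ) := by
  have := finite_standardMonomial y lt I n α
  have := Fintype.ofFinite (StandardMonomial y lt I n α)
  change (Module.finrank K (quotientComponent y _ α) : ℤ) = _
  rw [quotientComponent_eq_span y hlt hI n α,
    finrank_span_eq_card (linearIndependent_monomialClass y hlt hI hlfg hn),
    Nat.card_eq_fintype_card]

end

/-! ### The numerator of a monomial ideal -/

open Classical in
theorem coeff_prod_one_sub_X {σ : Type*} (s : Finset σ) (m : σ →₀ ℕ) :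
    MvPowerSeries.coeff m (∏ i ∈ s, (1 - MvPowerSeries.X i : MvPowerSeries σ ℤ)) =
      if (∀ i, m i ≤ 1) ∧ m.support ⊆ s then (-1) ^ m.degree else 0 := by
  induction s using Finset.induction_on generalizing m with
  | empty =>
    rw [Finset.prod_empty, MvPowerSeries.coeff_one]
    by_cases hm : m = 0
    · simp [hm]
    · rw [if_neg hm, if_neg]
      rintro ⟨-, h⟩
      exact hm (Finsupp.support_eq_empty.1 (Finset.subset_empty.1 h))
  | insert j s hj ih =>
    rw [Finset.prod_insert hj, sub_mul, one_mul, map_sub, ih, MvPowerSeries.X,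
      MvPowerSeries.coeff_monomial_mul, one_mul]
    have hsingle : Finsupp.single j 1 ≤ m ↔ 1 ≤ m j := Finsupp.single_le_iff
    by_cases hmj : m j = 0
    · have h1 : ¬ Finsupp.single j 1 ≤ m := by rw [hsingle]; omega
      have h2 : m.support ⊆ insert j s ↔ m.support ⊆ s :=
        Finset.subset_insert_iff_of_notMem (by simpa using hmj)
      rw [if_neg h1, sub_zero]
      simp only [h2]
    · have h1 : Finsupp.single j 1 ≤ m := hsingle.2 (by omega)
      obtain ⟨v, rfl⟩ := exists_add_of_le h1
      have hnot : ¬ (Finsupp.single j 1 + v).support ⊆ s := fun h =>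
        hj (h (Finsupp.mem_support_iff.2 hmj))
      rw [if_pos h1, add_tsub_cancel_left, ih, if_neg fun h => hnot h.2, zero_sub, map_add,
        Finsupp.degree_single, pow_add, pow_one]
      have hiff : ((∀ i, (Finsupp.single j 1 + v : σ →₀ ℕ) i ≤ 1) ∧
          (Finsupp.single j 1 + v).support ⊆ insert j s) ↔ (∀ i, v i ≤ 1) ∧ v.support ⊆ s := by
        constructor
        · rintro ⟨h, h'⟩
          have hv : v j = 0 := by
            have := h j
            rw [Finsupp.add_apply, Finsupp.single_eq_same] at this
            omega
          refine ⟨fun i => le_trans (by rw [Finsupp.add_apply]; omega) (h i), fun i hi => ?_⟩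
          have hi' := h' (Finsupp.mem_support_iff.2 (show (Finsupp.single j 1 + v : σ →₀ ℕ) i ≠ 0 by
            have := Finsupp.mem_support_iff.1 hi
            rw [Finsupp.add_apply]
            omega))
          rcases Finset.mem_insert.1 hi' with rfl | hi'
          · exact absurd hv (Finsupp.mem_support_iff.1 hi)
          · exact hi'
        · rintro ⟨h, h'⟩
          have hv : v j = 0 := by
            by_contra hne
            exact hj (h' (Finsupp.mem_support_iff.2 hne))
          refine ⟨fun i => ?_, fun i hi => ?_⟩
          · rw [Finsupp.add_apply]
            by_cases hij : i = j
            · rw [hij, hv, Finsupp.single_eq_same]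
            · rw [Finsupp.single_eq_of_ne hij, zero_add]
              exact h i
          · rw [Finset.mem_insert]
            by_cases hij : i = j
            · exact Or.inl hij
            · refine Or.inr (h' (Finsupp.mem_support_iff.2 ?_))
              have := Finsupp.mem_support_iff.1 hi
              rwa [Finsupp.add_apply, Finsupp.single_eq_of_ne hij, zero_add] at this
      simp only [hiff]
      split_ifs <;> simp

theorem coeff_mobius (m : ℕ →₀ ℕ) :
    MvPowerSeries.coeff m mobius = open Classical in if ∀ i, m i ≤ 1 then (-1) ^ m.degree else 0 :=
  rfl

theorem coeff_qSeries (J : Ideal (RP K)) (m : ℕ →₀ ℕ) :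
    MvPowerSeries.coeff m (qSeries J) = open Classical in if mon K m ∈ J then 0 else 1 := rfl

theorem killCompl_mobius (n : ℕ) :
    MvPowerSeries.killCompl (R := ℤ) (Fin.valEmbedding (n := n)) mobius =
      ∏ i : Fin n, (1 - MvPowerSeries.X i) := by
  classical
  ext m
  rw [MvPowerSeries.coeff_killCompl, coeff_mobius, coeff_prod_one_sub_X]
  change (if ∀ i, emb m i ≤ 1 then (-1) ^ (emb m).degree else 0) = _
  rw [degree_emb]
  have h : (∀ i, emb m i ≤ 1) ↔ (∀ i, m i ≤ 1) ∧ m.support ⊆ Finset.univ := by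
    constructor
    · intro h
      refine ⟨fun i => ?_, Finset.subset_univ _⟩
      have := h i
      rwa [emb, show (i : ℕ) = Fin.valEmbedding i from rfl, Finsupp.embDomain_apply_self] at this
    · rintro ⟨h, -⟩ i
      by_cases hi : i < n
      · rw [emb, show i = Fin.valEmbedding (⟨i, hi⟩ : Fin n) from rfl,
          Finsupp.embDomain_apply_self]
        exact h _
      · rw [mem_range_emb.1 ⟨m, rfl⟩ i (not_lt.1 hi)]
        exact Nat.zero_le _
  by_cases h' : ∀ i, emb m i ≤ 1
  · rw [if_pos h', if_pos (h.1 h')]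
  · rw [if_neg h', if_neg (mt h.2 h')]

theorem coeff_mobius_add_single {a : ℕ →₀ ℕ} {i : ℕ} (h : a i = 0) :
    MvPowerSeries.coeff (a + Finsupp.single i 1) mobius = -MvPowerSeries.coeff a mobius := by
  classical
  rw [coeff_mobius, coeff_mobius, map_add, Finsupp.degree_single, pow_succ]
  have hiff : (∀ j, (a + Finsupp.single i 1 : ℕ →₀ ℕ) j ≤ 1) ↔ ∀ j, a j ≤ 1 := by
    refine forall_congr' fun j => ?_
    rw [Finsupp.add_apply]
    by_cases hij : j = i
    · rw [hij, h, Finsupp.single_eq_same]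
      omega
    · rw [Finsupp.single_eq_of_ne hij, add_zero]
  simp only [hiff]
  split_ifs <;> simp

/-- If membership in `J` does not depend on the exponent of `x_i`, up to degree `d`, then the terms
of `∏ (1 - x_j) * q(J)` that involve `x_i` cancel. -/
theorem coeff_pSeries_eq_zero {J : Ideal (RP K)} {i : ℕ} {m : ℕ →₀ ℕ}
    (hJ : ∀ b : ℕ →₀ ℕ, (b + Finsupp.single i 1).degree ≤ m.degree →
      (mon K (b + Finsupp.single i 1) ∈ J ↔ mon K b ∈ J)) (hm : m i ≠ 0) :
    MvPowerSeries.coeff m (pSeries J) = 0 := by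
  classical
  set s : ℕ →₀ ℕ := Finsupp.single i 1 with hs
  have hsi : s i = 1 := Finsupp.single_eq_same
  have hle : ∀ a : ℕ →₀ ℕ, a i ≠ 0 → s ≤ a := fun a ha => by
    rw [hs, Finsupp.single_le_iff]
    omega
  have hcancel : ∀ a b : ℕ →₀ ℕ, a + s + b = m → a i = 0 →
      MvPowerSeries.coeff (a + s) mobius * MvPowerSeries.coeff b (qSeries J) +
        MvPowerSeries.coeff a mobius * MvPowerSeries.coeff (b + s) (qSeries J) = 0 := by
    intro a b hab ha
    have hd : (b + s).degree ≤ m.degree := by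
      rw [← hab, map_add, map_add, map_add]
      omega
    rw [coeff_mobius_add_single ha, coeff_qSeries, coeff_qSeries]
    simp only [hJ b hd]
    ring
  rw [pSeries, MvPowerSeries.coeff_mul]
  -- The involution moves one factor `x_i` between the two monomials.
  refine Finset.sum_involution
    (fun x _ => if x.1 i = 0 then (x.1 + s, x.2 - s) else
      if x.1 i = 1 then (x.1 - s, x.2 + s) else x) ?_ ?_ ?_ ?_
  · rintro ⟨a, b⟩ hx
    rw [Finset.HasAntidiagonal.mem_antidiagonal] at hx
    simp only at hx ⊢
    have hmi : a i + b i = m i := by rw [← hx, Finsupp.add_apply]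
    split_ifs with h0 h1
    · obtain ⟨b, rfl⟩ := exists_add_of_le (hle b (by omega))
      rw [add_tsub_cancel_left, add_comm, add_comm s b]
      exact hcancel a b (by rw [← hx, add_assoc]) h0
    · obtain ⟨a, rfl⟩ := exists_add_of_le (hle a (by omega))
      rw [add_tsub_cancel_left, add_comm s a]
      rw [Finsupp.add_apply, hsi] at h1
      exact hcancel a b (by rw [← hx, add_comm s a]) (by omega)
    · have : MvPowerSeries.coeff a mobius = 0 := by
        rw [coeff_mobius, if_neg]
        intro h
        have := h i
        omega
      simp [this]
  · rintro ⟨a, b⟩ hx hne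
    simp only at hne ⊢
    split_ifs with h0 h1
    · intro h
      have h2 := DFunLike.congr_fun (Prod.ext_iff.1 h).1 i
      simp only [Finsupp.add_apply, hsi] at h2
      omega
    · intro h
      have h2 := DFunLike.congr_fun (Prod.ext_iff.1 h).2 i
      simp only [Finsupp.add_apply, hsi] at h2
      omega
    · refine absurd ?_ (left_ne_zero_of_mul hne)
      rw [coeff_mobius, if_neg]
      intro h
      have := h i
      omega
  · rintro ⟨a, b⟩ hx
    rw [Finset.HasAntidiagonal.mem_antidiagonal] at hx ⊢
    simp only at hx ⊢
    have hmi : a i + b i = m i := by rw [← hx, Finsupp.add_apply]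
    split_ifs with h0 h1
    · simp only
      rw [add_assoc, add_tsub_cancel_of_le (hle b (by omega)), hx]
    · simp only
      rw [add_comm b, ← add_assoc, tsub_add_cancel_of_le (hle a (by omega)), hx]
    · exact hx
  · rintro ⟨a, b⟩ hx
    rw [Finset.HasAntidiagonal.mem_antidiagonal] at hx
    simp only at hx ⊢
    have hmi : a i + b i = m i := by rw [← hx, Finsupp.add_apply]
    by_cases h0 : a i = 0
    · have h1 : (a + s) i = 1 := by rw [Finsupp.add_apply, h0, hsi]
      simp only [h0, if_true, h1, one_ne_zero, if_false]
      rw [add_tsub_cancel_right, tsub_add_cancel_of_le (hle b (by omega))]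
    · by_cases h1 : a i = 1
      · have h2 : (a - s) i = 0 := by rw [Finsupp.tsub_apply, h1, hsi]
        simp only [h1, one_ne_zero, if_true, h2, if_false]
        rw [add_tsub_cancel_right, tsub_add_cancel_of_le (hle a (by omega))]
      · simp only [h0, h1, if_false]

section

variable {lt : (ℕ →₀ ℕ) → (ℕ →₀ ℕ) → Prop}

/-- Up to degree `d`, the numerator of the initial ideal involves only the variables that occur in
the minimal initial monomials. -/
theorem coeff_pSeries_initialIdeal_eq_zero (hlt : IsTermOrder lt) {I : Ideal (RP K)} {d n : ℕ}
    (hn : ∀ t ∈ minimalInitial lt I, t.degree ≤ d → ∀ i, n ≤ i → t i = 0) {m : ℕ →₀ ℕ}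
    (hmd : m.degree ≤ d) (hm : m ∉ Set.range (emb (n := n))) :
    MvPowerSeries.coeff m (pSeries (initialIdeal lt I)) = 0 := by
  rw [mem_range_emb] at hm
  push Not at hm
  obtain ⟨i, hi, hmi⟩ := hm
  refine coeff_pSeries_eq_zero (i := i) (fun b hb => ?_) hmi
  rw [mon_mem_initialIdeal hlt, mon_mem_initialIdeal hlt]
  constructor
  · intro h
    obtain ⟨t, ht, hle⟩ := exists_minimalInitial_le h
    refine mem_initialMonomials_of_le hlt ht.1 fun j => ?_
    have hti := hn t ht ((Finsupp.degree_mono hle).trans (hb.trans hmd)) i hi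
    by_cases hij : j = i
    · rw [hij, hti]
      exact Nat.zero_le _
    · have := hle j
      rwa [Finsupp.add_apply, Finsupp.single_eq_of_ne hij, add_zero] at this
  · exact fun h => mem_initialMonomials_of_le hlt h le_self_add

theorem isCollapsible_pSeries {r : ℕ} (y : ℕ → Fin r) (hlt : IsTermOrder lt)
    {I : Ideal (RP K)} (hI : IsRHomogeneous y I) (hlfg : IsLFG I) :
    IsCollapsible (pSeries (initialIdeal lt I)) := by
  intro d
  obtain ⟨n, hn⟩ := exists_variable_bound y hlt hI hlfg d
  refine ((Finsupp.finite_of_degree_le (σ := Fin n) d).image emb).subset ?_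
  rintro m ⟨hmd, hm⟩
  have h : m ∈ Set.range (emb (n := n)) := by
    by_contra h
    exact hm (coeff_pSeries_initialIdeal_eq_zero hlt hn hmd.le h)
  obtain ⟨m, rfl⟩ := h
  rw [degree_emb] at hmd
  exact ⟨m, hmd.le, rfl⟩

theorem mapDomain_eq_multideg_emb {r n : ℕ} (y : ℕ → Fin r) (m : Fin n →₀ ℕ) :
    Finsupp.mapDomain (fun i : Fin n => y i) m = multideg y (emb m) := by
  rw [multideg_emb, Finsupp.weight_apply, Finsupp.mapDomain]
  simp only [Finsupp.smul_single, smul_eq_mul, mul_one]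

theorem coeff_rename_killCompl {r : ℕ} (y : ℕ → Fin r) (n : ℕ) (α : Fin r →₀ ℕ)
    (f : MvPowerSeries ℕ ℤ) :
    MvPowerSeries.coeff α (MvPowerSeries.rename (fun i : Fin n => y i)
      (MvPowerSeries.killCompl (R := ℤ) Fin.valEmbedding f)) =
      ∑ m ∈ (finite_multideg_emb y n α).toFinset, MvPowerSeries.coeff (emb m) f := by
  rw [MvPowerSeries.coeff_rename]
  refine Finset.sum_congr ?_ fun m _ => rfl
  ext m
  rw [Set.Finite.mem_toFinset, Set.Finite.mem_toFinset, Set.mem_preimage, Set.mem_singleton_iff,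
    mapDomain_eq_multideg_emb]
  rfl

/-- The Hilbert numerator is obtained from the numerator of the initial ideal by collapsing: in
degrees at most `d` and for large `n`, the truncated Hilbert series is the image of the series of
all monomials outside the initial ideal in the first `n` variables. -/
theorem isHilbertNumerator_collapse {r : ℕ} (y : ℕ → Fin r) (hlt : IsTermOrder lt)
    {I : Ideal (RP K)} (hI : IsRHomogeneous y I) (hlfg : IsLFG I) :
    IsHilbertNumerator y I (collapse y (pSeries (initialIdeal lt I))) := by
  classical
  intro d
  obtain ⟨N, hN⟩ := exists_variable_bound y hlt hI hlfg d
  refine ⟨N, fun n hNn α hα => ?_⟩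
  have hn : ∀ t ∈ minimalInitial lt I, t.degree ≤ d → ∀ i, n ≤ i → t i = 0 :=
    fun t ht htd i hi => hN t ht htd i (hNn.trans hi)
  set φ := MvPowerSeries.rename (R := ℤ) (fun i : Fin n => y i) with hφ
  have hq : ∀ β : Fin r →₀ ℕ, β.degree ≤ d →
      MvPowerSeries.coeff β (hilbertSeries y (I.map (restr (K := K) n))) =
        MvPowerSeries.coeff β (φ (MvPowerSeries.killCompl (R := ℤ) Fin.valEmbedding
          (qSeries (initialIdeal lt I)))) := by
    intro β hβ
    rw [coeff_hilbertSeries y hlt hI hlfg (fun t ht htd => hn t ht (htd.trans hβ)), hφ,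
      coeff_rename_killCompl]
    simp only [coeff_qSeries, mon_mem_initialIdeal hlt]
    have h1 : Nat.card (StandardMonomial y lt I n β) =
        ((finite_multideg_emb y n β).toFinset.filter
          fun m => emb m ∉ initialMonomials lt I).card :=
      Nat.subtype_card _ fun m => by
        rw [Finset.mem_filter, Set.Finite.mem_toFinset]
        rfl
    rw [h1, Finset.card_filter, Nat.cast_sum]
    refine Finset.sum_congr rfl fun m _ => ?_
    by_cases h : emb m ∈ initialMonomials lt I <;> simp [h]
  have hmu : ∏ i : Fin n, (1 - MvPowerSeries.X (y i) : MvPowerSeries (Fin r) ℤ) =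
      φ (MvPowerSeries.killCompl (R := ℤ) Fin.valEmbedding mobius) := by
    rw [killCompl_mobius, map_prod]
    refine Finset.prod_congr rfl fun i _ => ?_
    rw [map_sub, map_one, hφ, MvPowerSeries.rename_X]
  have hleft : MvPowerSeries.coeff α (truncatedNumerator y I n) =
      MvPowerSeries.coeff α (φ (MvPowerSeries.killCompl (R := ℤ) Fin.valEmbedding
        (pSeries (initialIdeal lt I)))) := by
    rw [pSeries, mul_comm, map_mul, map_mul, ← hmu, truncatedNumerator, MvPowerSeries.coeff_mul,
      MvPowerSeries.coeff_mul]
    refine Finset.sum_congr rfl fun x hx => ?_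
    rw [Finset.HasAntidiagonal.mem_antidiagonal] at hx
    rw [hq]
    rw [← hx, map_add] at hα
    omega
  rw [hleft, hφ, coeff_rename_killCompl]
  change _ = ∑ᶠ m ∈ {m : ℕ →₀ ℕ | multideg y m = α}, _
  rw [← Finset.sum_image (f := fun m => MvPowerSeries.coeff m (pSeries (initialIdeal lt I)))
    fun a _ b _ h => emb_injective n h]
  refine (finsum_mem_eq_sum_of_inter_support_eq _ ?_).symm
  ext m
  simp only [Set.mem_inter_iff, Finset.coe_image, Set.Finite.coe_toFinset, Function.mem_support]
  refine and_congr_left fun hne => ⟨fun hm => ?_, ?_⟩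
  · have h : m ∈ Set.range (emb (n := n)) := by
      by_contra h
      refine hne (coeff_pSeries_initialIdeal_eq_zero hlt hn ?_ h)
      rw [← degree_multideg y, show multideg y m = α from hm]
      exact hα
    obtain ⟨m, rfl⟩ := h
    exact ⟨m, hm, rfl⟩
  · rintro ⟨m, hm, rfl⟩
    exact hm

end

end LargePoly

end

theorem mainTheorem11 {K : Type*} [Field K] [CharZero K] {r : ℕ} (y : ℕ → Fin r) :
    (∀ I : Ideal (LargePoly.RP K), LargePoly.IsRHomogeneous y I → LargePoly.IsLFG I →
      ∀ lt : (ℕ →₀ ℕ) → (ℕ →₀ ℕ) → Prop, LargePoly.IsTermOrder lt →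
        LargePoly.IsMonomialIdeal (LargePoly.initialIdeal lt I) ∧
        LargePoly.IsRHomogeneous y (LargePoly.initialIdeal lt I) ∧
        LargePoly.IsLFG (LargePoly.initialIdeal lt I) ∧
        LargePoly.IsCollapsible (LargePoly.pSeries (LargePoly.initialIdeal lt I)) ∧
        ∃ g : MvPowerSeries (Fin r) ℤ,
          LargePoly.IsHilbertNumerator y I g ∧
          LargePoly.IsHilbertNumerator y (LargePoly.initialIdeal lt I) g ∧
          g = LargePoly.collapse y (LargePoly.pSeries (LargePoly.initialIdeal lt I))) ∧
    {g : MvPowerSeries (Fin r) ℤ | ∃ I : Ideal (LargePoly.RP K),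
        LargePoly.IsRHomogeneous y I ∧ LargePoly.IsLFG I ∧
        LargePoly.IsHilbertNumerator y I g} =
      {g : MvPowerSeries (Fin r) ℤ | ∃ J : Ideal (LargePoly.RP K),
        LargePoly.IsMonomialIdeal J ∧ LargePoly.IsLFG J ∧
        LargePoly.IsHilbertNumerator y J g} ∧
    {g : MvPowerSeries (Fin r) ℤ | ∃ I : Ideal (LargePoly.RP K),
        LargePoly.IsRHomogeneous y I ∧ LargePoly.IsLFG I ∧
        LargePoly.IsHilbertNumerator y I g} =
      {g : MvPowerSeries (Fin r) ℤ | ∃ J : Ideal (LargePoly.RP K),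
        LargePoly.IsMonomialIdeal J ∧ LargePoly.IsLFG J ∧
        g = LargePoly.collapse y (LargePoly.pSeries J)} := by
  have hnum : ∀ I : Ideal (LargePoly.RP K), LargePoly.IsRHomogeneous y I → LargePoly.IsLFG I →
      ∀ lt : (ℕ →₀ ℕ) → (ℕ →₀ ℕ) → Prop, LargePoly.IsTermOrder lt →
        LargePoly.IsHilbertNumerator y I
          (LargePoly.collapse y (LargePoly.pSeries (LargePoly.initialIdeal lt I))) :=
    fun I hI hlfg lt hlt => LargePoly.isHilbertNumerator_collapse y hlt hI hlfg
  have hmon : ∀ J : Ideal (LargePoly.RP K), LargePoly.IsMonomialIdeal J → LargePoly.IsLFG J →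
      LargePoly.IsHilbertNumerator y J (LargePoly.collapse y (LargePoly.pSeries J)) := by
    intro J hJ hlfg
    obtain ⟨lt, hlt⟩ := LargePoly.exists_isTermOrder
    have h := hnum J (hJ.isRHomogeneous y) hlfg lt hlt
    rwa [hJ.initialIdeal_eq] at h
  obtain ⟨lt₀, hlt₀⟩ := LargePoly.exists_isTermOrder
  refine ⟨fun I hI hlfg lt hlt => ?_, ?_, ?_⟩
  · have hin := LargePoly.isMonomialIdeal_initialIdeal (lt := lt) I
    have hinlfg := LargePoly.isLFG_initialIdeal y hlt hI hlfg
    exact ⟨hin, hin.isRHomogeneous y, hinlfg, LargePoly.isCollapsible_pSeries y hlt hI hlfg, _,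
      hnum I hI hlfg lt hlt, hmon _ hin hinlfg, rfl⟩
  · ext g
    constructor
    · rintro ⟨I, hI, hlfg, hg⟩
      have hin := LargePoly.isMonomialIdeal_initialIdeal (lt := lt₀) I
      have hinlfg := LargePoly.isLFG_initialIdeal y hlt₀ hI hlfg
      refine ⟨_, hin, hinlfg, ?_⟩
      rw [hg.unique (hnum I hI hlfg lt₀ hlt₀)]
      exact hmon _ hin hinlfg
    · rintro ⟨J, hJ, hlfg, hg⟩
      exact ⟨J, hJ.isRHomogeneous y, hlfg, hg⟩
  · ext g
    constructor
    · rintro ⟨I, hI, hlfg, hg⟩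
      exact ⟨_, LargePoly.isMonomialIdeal_initialIdeal (lt := lt₀) I,
        LargePoly.isLFG_initialIdeal y hlt₀ hI hlfg, hg.unique (hnum I hI hlfg lt₀ hlt₀)⟩
    · rintro ⟨J, hJ, hlfg, rfl⟩
      exact ⟨J, hJ.isRHomogeneous y, hlfg, hmon J hJ hlfg⟩
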